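/- Let $X_1, X_2, \dots$ be i.i.d. real random variables with continuous distribution function $F$, and assume the symmetry hypothesis $H_0$: $1-F(x)-F(-x)=0$ for all $x\in\mathbb{R}$. Let $$\Phi(x_1,x_2,x_3)=\frac1{3!}\sum_{\pi}\Big(\mathrm I\{|x_{\pi(1)}-x_{\pi(2)}|<|x_{\pi(3)}|\}-\mathrm I\{|x_{\pi(1)}+x_{\pi(2)}|<|x_{\pi(3)}|\}\Big),$$ where $\pi$ runs over all permutations of $\{1,2,3\}$, and let $$J_n=\binom n3^{-1}\sum_{1\le i<j<k\le n}\Phi(X_i,X_j,X_k)$$ for $n \ge 3$. Let $\varphi_F(s,t)=\tfrac23\big(F(|s+t|)-F(|s-t|)\big)$ and let $\mathcal J_F$ be the integral operator on $L^2(\mathbb{R},dF)$ given by $(\mathcal J_F v)(x)=\int_{\mathbb R}\varphi_F(x,y)v(y)\,dF(y)$. Then the nonzero eigenvalues of $\mathcal J_F$, each repeated according to its multiplicity (the dimension of its eigenspace) and padded with zeros if there are only finitely many, can be listed in a sequence $(\nu_i(F))_{i\ge1}$ with $|\nu_i(F)|$ non-increasing. Moreover, for every sequence $(\nu_i(F))_{i\ge1}$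 listing the nonzero eigenvalues with multiplicity (in any order, possibly with additional zeros) and every sequence $(W_i)_{i\ge1}$ of i.i.d. standard normal random variables, the series $\sum_{i=1}^\infty\nu_i(F)(W_i^2-1)$ converges almost surely and, as $n\to\infty$, $$nJ_n\xrightarrow{\ d\ }\binom32\sum_{i=1}^{\infty}\nu_i(F)\big(W_i^2-1\big).$$ -/

import Mathlib

open MeasureTheory ProbabilityTheory Filter Topology

noncomputable section

/-- The indicator of a proposition, as a real number. -/
def ind (p : Prop) : ℝ := by
  classical exact if p then 1 else 0

/-- The kernel `Φ(x₀, x₁, x₂)`: the average over all permutations `π` of three indices of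
`I{|x_{π 0} - x_{π 1}| < |x_{π 2}|} - I{|x_{π 0} + x_{π 1}| < |x_{π 2}|}`. -/
def kernelPhi (x : Fin 3 → ℝ) : ℝ :=
  ((Nat.factorial 3 : ℕ) : ℝ)⁻¹ * ∑ π : Equiv.Perm (Fin 3),
    (ind (|x (π 0) - x (π 1)| < |x (π 2)|) - ind (|x (π 0) + x (π 1)| < |x (π 2)|))

/-- The U-statistic `J_n` with kernel `Φ`, evaluated on the sample `x 0, …, x (n - 1)`; the sum
runs over all triples `i < j < k` of sample indices. -/
def statJ (n : ℕ) (x : ℕ → ℝ) : ℝ :=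
  ((n.choose 3 : ℕ) : ℝ)⁻¹ *
    ∑ k ∈ Finset.range n, ∑ j ∈ Finset.range k, ∑ i ∈ Finset.range j,
      kernelPhi ![x i, x j, x k]

/-- The kernel `φ_F(s, t) = (2/3) (F(|s + t|) - F(|s - t|))`, with `F` the distribution function
of `μ`. -/
def projKernel (μ : Measure ℝ) (s t : ℝ) : ℝ :=
  2 / 3 * (cdf μ |s + t| - cdf μ |s - t|)

theorem measurable_projKernel (μ : Measure ℝ) :
    Measurable (fun p : ℝ × ℝ => projKernel μ p.1 p.2) := by
  have h : Measurable (cdf μ) := (monotone_cdf μ).measurable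
  have h1 : Measurable (fun p : ℝ × ℝ => |p.1 + p.2|) := by fun_prop
  have h2 : Measurable (fun p : ℝ × ℝ => |p.1 - p.2|) := by fun_prop
  exact ((h.comp h1).sub (h.comp h2)).const_mul _

theorem abs_projKernel_le (μ : Measure ℝ) (s t : ℝ) : |projKernel μ s t| ≤ 1 := by
  have h1 := cdf_nonneg μ |s + t|
  have h2 := cdf_le_one μ |s + t|
  have h3 := cdf_nonneg μ |s - t|
  have h4 := cdf_le_one μ |s - t|
  unfold projKernel
  rw [abs_le]
  constructor <;> linarith

theorem integrable_projKernel_mul (μ : Measure ℝ) [IsProbabilityMeasure μ] (v : Lp ℝ 2 μ)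
    (x : ℝ) : Integrable (fun y => projKernel μ x y * v y) μ := by
  have hv : Integrable (fun y => v y) μ := (Lp.memLp v).integrable (by norm_num)
  refine hv.bdd_mul (c := 1) ?_ ?_
  · exact ((measurable_projKernel μ).comp measurable_prodMk_left).aestronglyMeasurable
  · exact Eventually.of_forall fun y => by
      simpa [Real.norm_eq_abs] using abs_projKernel_le μ x y

theorem memLp_integral_projKernel (μ : Measure ℝ) [IsProbabilityMeasure μ] (v : Lp ℝ 2 μ) :
    MemLp (fun x => ∫ y, projKernel μ x y * v y ∂μ) 2 μ := by
  have hv : Integrable (fun y => v y) μ := (Lp.memLp v).integrable (by norm_num)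
  refine MemLp.of_bound (C := ∫ y, ‖v y‖ ∂μ) ?_ ?_
  · have hm : StronglyMeasurable (fun p : ℝ × ℝ => projKernel μ p.1 p.2 * v p.2) :=
      (measurable_projKernel μ).stronglyMeasurable.mul
        ((Lp.stronglyMeasurable v).comp_measurable measurable_snd)
    exact hm.integral_prod_right.aestronglyMeasurable
  · refine Eventually.of_forall fun x => ?_
    refine norm_integral_le_of_norm_le hv.norm (Eventually.of_forall fun y => ?_)
    rw [norm_mul]
    exact mul_le_of_le_one_left (norm_nonneg _)
      (by simpa [Real.norm_eq_abs] using abs_projKernel_le μ x y)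

/-- The integral operator `(𝒥_F v)(x) = ∫ φ_F(x, y) v(y) dF(y)` on the Hilbert space `L²(ℝ, dF)`,
with `F` the distribution function of `μ`. -/
def opJ (μ : Measure ℝ) [IsProbabilityMeasure μ] : Lp ℝ 2 μ →ₗ[ℝ] Lp ℝ 2 μ where
  toFun v := (memLp_integral_projKernel μ v).toLp _
  map_add' u v := by
    rw [← MemLp.toLp_add, MemLp.toLp_eq_toLp_iff]
    refine Eventually.of_forall fun x => ?_
    simp only [Pi.add_apply]
    rw [← integral_add (integrable_projKernel_mul μ u x) (integrable_projKernel_mul μ v x)]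
    refine integral_congr_ae ?_
    filter_upwards [Lp.coeFn_add u v] with y hy
    rw [hy, Pi.add_apply, mul_add]
  map_smul' c v := by
    rw [RingHom.id_apply, ← MemLp.toLp_const_smul, MemLp.toLp_eq_toLp_iff]
    refine Eventually.of_forall fun x => ?_
    simp only [Pi.smul_apply, smul_eq_mul]
    rw [← integral_const_mul]
    refine integral_congr_ae ?_
    filter_upwards [Lp.coeFn_smul c v] with y hy
    rw [hy, Pi.smul_apply, smul_eq_mul]
    ring

/-- The sequence `ν` lists the nonzero eigenvalues of `T`, each one as often as its multiplicity
(the dimension of its eigenspace). The value `0` may occur any number of times; in particular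
`ν` is padded with zeros if there are only finitely many nonzero eigenvalues. -/
def IsEigenvalueSeq {E : Type*} [AddCommGroup E] [Module ℝ E] (T : E →ₗ[ℝ] E) (ν : ℕ → ℝ) :
    Prop :=
  ∀ r : ℝ, r ≠ 0 →
    {i : ℕ | ν i = r}.encard = Cardinal.toENat (Module.rank ℝ (Module.End.eigenspace T r))

end

/-! Continuity of the distribution function and `hH₀` make `μ` invariant under `x ↦ -x`. Put `k(x,
y, z) = I{|x - y| < |z|} - I{|x + y| < |z|}`, which is symmetric in `x, y` and odd in each. The
kernel `Φ` is the mean of `k(x, y, z)`, `k(x, z, y)`, `k(y, z, x)`; integrating out `x` kills the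
first two by oddness and turns the third into `3 φ_F(y, z)`. As `φ_F` is odd in each argument too,
the Hoeffding decomposition of `Φ` has neither a constant nor a linear term: `Φ` is the sum of `φ_F`
over the three pairs plus a remainder centred in each variable.

Hence (`mul_statJ_eq`) `n J_n` equals `6 / (n - 1)` times the sum of `φ_F` over pairs, plus a term
whose second moment is `O(1/n)` because distinct triples are uncorrelated. The operator with kernel
`φ_F` is symmetric and Hilbert-Schmidt, so eigenvectors `e i` diagonalise it and the `ν i ^ 2` sum
to the squared norm of `φ_F` (`IsEigenvalueSeq.hasSum_sq`). Cutting `φ_F` down to finitely many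
terms `ν i * e i x * e i y` changes the quadratic statistic in `L²`, uniformly in `n`, by at most a
constant times the square root of the tail of `∑ ν i ^ 2`.

For a finite rank kernel the quadratic statistic is a weighted sum of squared normalised sums minus
empirical means of `e i ^ 2`. The multivariate central limit theorem, the law of large numbers and
Slutsky's theorem give the limit `3 ∑ ν i (W i ^ 2 - 1)` (`tendsto_charFun_quadraticPart`). The
infinite series converges almost surely as an `L²`-bounded martingale, and comparing characteristic
functions lets the rank tend to infinity. -/

noncomputable section

/-! ### Hilbert-Schmidt operators are compact -/

section HilbertSchmidt

variable {E : Type*} [NormedAddCommGroup E] [InnerProductSpace ℝ E]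

theorem isCompactOperator_smulRight (u : E) (f : E →L[ℝ] ℝ) :
    IsCompactOperator (f.smulRight u) := by
  have h : IsCompactOperator (id : ℝ → ℝ) :=
    (isCompactOperator_id_iff_finiteDimensional (𝕜 := ℝ)).2 inferInstance
  have h2 := (h.comp_clm f).clm_comp (ContinuousLinearMap.toSpanSingleton ℝ u)
  exact h2

theorem isCompactOperator_finset_sum {ι : Type*} (s : Finset ι) (K : ι → E →L[ℝ] E)
    (hK : ∀ i, IsCompactOperator (K i)) : IsCompactOperator (∑ i ∈ s, K i : E →L[ℝ] E) := by
  classical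
  induction s using Finset.induction_on with
  | empty => simpa using isCompactOperator_zero
  | insert a s ha ih =>
    rw [Finset.sum_insert ha]
    exact (hK a).add ih

/-- An operator whose values on a Hilbert basis are square summable is compact. -/
theorem isCompactOperator_of_summable_norm_sq {ι : Type*} (b : HilbertBasis ι ℝ E) (T : E →L[ℝ] E)
    [CompleteSpace E] (h : Summable fun i => ‖T (b i)‖ ^ 2) : IsCompactOperator T := by
  classical
  set F : Finset ι → E →L[ℝ] E := fun s =>
    ∑ i ∈ s, (innerSL ℝ (b i)).smulRight (T (b i)) with hF
  have hFv : ∀ s v, F s v = ∑ i ∈ s, inner ℝ (b i) v • T (b i) := by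
    intro s v
    simp [hF]
  refine isCompactOperator_of_tendsto (l := atTop) (F := F) ?_ (Eventually.of_forall fun s =>
    isCompactOperator_finset_sum s _ fun i => isCompactOperator_smulRight _ _)
  rw [Metric.tendsto_atTop]
  intro ε hε
  obtain ⟨s, hs⟩ := summable_iff_vanishing_norm.1 h ((ε / 2) ^ 2) (by positivity)
  refine ⟨s, fun s' hss' => ?_⟩
  rw [dist_comm, dist_eq_norm]
  refine lt_of_le_of_lt ?_ (half_lt_self hε)
  refine ContinuousLinearMap.opNorm_le_bound _ (by positivity) fun v => ?_
  -- The tail is bounded on finite partial sums, then in the limit. Cauchy-Schwarz splits a partial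
  -- sum into a factor at most `ε / 2`, by the choice of `s`, and one at most `‖v‖`, by Bessel.
  have hlim : Tendsto (fun t => F t v - F s' v) atTop (𝓝 ((T - F s') v)) := by
    have h1 : HasSum (fun i => inner ℝ (b i) v • T (b i)) (T v) := by
      have := (b.hasSum_repr v).mapL T
      simpa [HilbertBasis.repr_apply_apply] using this
    have h2 : Tendsto (fun t => F t v) atTop (𝓝 (T v)) := by
      simpa only [hFv, HasSum, SummationFilter.unconditional_filter] using h1
    simpa using h2.sub_const (F s' v)
  refine le_of_tendsto hlim.norm ?_
  filter_upwards [eventually_ge_atTop s'] with t ht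
  rw [hFv, hFv, ← Finset.sum_sdiff ht, add_sub_cancel_right]
  refine (norm_sum_le _ _).trans ?_
  simp only [norm_smul]
  refine (Real.sum_mul_le_sqrt_mul_sqrt _ _ _).trans ?_
  rw [mul_comm]
  have hd : Disjoint (t \ s') s :=
    Finset.disjoint_of_subset_right hss' Finset.sdiff_disjoint
  have h1 := hs _ hd
  rw [Real.norm_of_nonneg (Finset.sum_nonneg fun _ _ => by positivity)] at h1
  refine mul_le_mul ?_ ?_ (Real.sqrt_nonneg _) (by positivity)
  · exact Real.sqrt_le_iff.2 ⟨by positivity, h1.le⟩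
  · exact Real.sqrt_le_iff.2 ⟨norm_nonneg _, b.orthonormal.sum_inner_products_le v⟩

/-- Orthonormal vectors lie at distance `√2`, so the balls of radius `1 / 2` around them are
disjoint open sets in a separable space. -/
theorem Orthonormal.countable_index [SecondCountableTopology E] {ι : Type*} {v : ι → E}
    (hv : Orthonormal ℝ v) : Countable ι := by
  have : Pairwise fun i j => 1 ≤ dist (v i) (v j) := by
    intro i j hij
    have h : ‖v i - v j‖ ^ 2 = 2 := by
      rw [norm_sub_sq_real, hv.1 i, hv.1 j, hv.2 hij]; norm_num
    rw [dist_eq_norm]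
    nlinarith [norm_nonneg (v i - v j)]
  have hd : (Set.univ : Set ι).PairwiseDisjoint fun i => Metric.ball (v i) (1 / 2) := by
    intro i _ j _ hij
    exact Metric.ball_disjoint_ball (by norm_num; exact this hij)
  exact Set.countable_univ_iff.1 (hd.countable_of_isOpen (fun _ _ => Metric.isOpen_ball)
    fun i _ => ⟨v i, Metric.mem_ball_self (by norm_num)⟩)

end HilbertSchmidt

/-- A nonnegative function that has only finitely many values above any positive level can be
listed in decreasing order. -/
theorem exists_antitone_enumeration {ι : Type*} [Infinite ι] (f : ι → ℝ) (hf : ∀ i, 0 ≤ f i)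
    (hfin : ∀ ε > 0, {i | ε ≤ f i}.Finite) :
    ∃ a : ℕ → ι, Function.Injective a ∧ Antitone (fun n => f (a n)) ∧
      ∀ i, 0 < f i → i ∈ Set.range a := by
  classical
  have hmax : ∀ s : Finset ι, ∃ i, i ∉ s ∧ ∀ j, j ∉ s → f j ≤ f i := by
    intro s
    by_cases h : ∃ i, i ∉ s ∧ 0 < f i
    · obtain ⟨i, his, hi⟩ := h
      have hfi := hfin _ hi
      obtain ⟨m, hm, hmax⟩ := Finset.exists_max_image (hfi.toFinset \ s) f
        ⟨i, by simp [his]⟩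
      simp only [Finset.mem_sdiff, Set.Finite.mem_toFinset, Set.mem_ofPred_eq] at hm hmax
      refine ⟨m, hm.2, fun j hj => ?_⟩
      by_cases hij : f i ≤ f j
      · exact hmax j ⟨hij, hj⟩
      · exact (not_le.1 hij).le.trans hm.1
    · push Not at h
      obtain ⟨i, hi⟩ := Infinite.exists_notMem_finset s
      exact ⟨i, hi, fun j hj => (h j hj).trans (hf i)⟩
  -- Greedy choice: `g s` maximises `f` outside `s`, and `S n` collects the first `n` choices.
  choose g hg hgmax using hmax
  let S : ℕ → Finset ι := fun n => Nat.rec ∅ (fun _ s => insert (g s) s) n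
  have hS : ∀ n, S (n + 1) = insert (g (S n)) (S n) := fun n => rfl
  have hmono : Monotone S := monotone_nat_of_le_succ fun n => by
    rw [hS]; exact Finset.subset_insert _ _
  have hmem : ∀ m n, m < n → g (S m) ∈ S n := fun m n h =>
    hmono (Nat.succ_le_of_lt h) (by rw [Nat.succ_eq_add_one, hS]; exact Finset.mem_insert_self _ _)
  have hinj : Function.Injective fun n => g (S n) := by
    intro m n h
    by_contra hne
    rcases lt_or_gt_of_ne hne with hlt | hlt
    · exact hg (S n) (by have := hmem m n hlt; rwa [show g (S m) = g (S n) from h] at this)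
    · exact hg (S m) (by have := hmem n m hlt; rwa [← show g (S m) = g (S n) from h] at this)
  refine ⟨fun n => g (S n), hinj, ?_, ?_⟩
  · intro m n hmn
    exact hgmax (S m) _ fun h => hg (S n) (hmono hmn h)
  · intro i hi
    by_contra hni
    have hS' : ∀ n, i ∉ S n := by
      intro n
      induction n with
      | zero => exact Finset.notMem_empty i
      | succ n ih =>
        rw [hS, Finset.mem_insert, not_or]
        exact ⟨fun h => hni ⟨n, h.symm⟩, ih⟩
    -- An index that is never chosen has a value at most that of every choice, so infinitely many
    -- values would be at least `f i > 0`.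
    refine (Set.infinite_range_of_injective hinj) ((hfin _ hi).subset ?_)
    rintro _ ⟨n, rfl⟩
    exact hgmax (S n) i (hS' n)

/-! ### The integral operator is symmetric and Hilbert-Schmidt -/

section KernelOperator

variable (μ : Measure ℝ)

theorem projKernel_comm (s t : ℝ) : projKernel μ s t = projKernel μ t s := by
  unfold projKernel
  rw [add_comm, abs_sub_comm]

theorem projKernel_sq_le_one (s t : ℝ) : projKernel μ s t ^ 2 ≤ 1 := by
  rw [← sq_abs]
  exact pow_le_one₀ (abs_nonneg _) (abs_projKernel_le μ s t)

theorem norm_sq_eq_integral (v : Lp ℝ 2 μ) : ‖v‖ ^ 2 = ∫ x, v x ^ 2 ∂μ := by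
  rw [← real_inner_self_eq_norm_sq, L2.inner_def]
  simp [pow_two]

variable [IsProbabilityMeasure μ]

theorem memLp_projKernel (x : ℝ) : MemLp (projKernel μ x) 2 μ :=
  MemLp.of_bound ((measurable_projKernel μ).comp measurable_prodMk_left).aestronglyMeasurable 1
    (Eventually.of_forall fun y => abs_projKernel_le μ x y)

/-- The section `φ_F(x, ·)` of the kernel, as an element of `L²`. -/
def kernelSection (x : ℝ) : Lp ℝ 2 μ := (memLp_projKernel μ x).toLp _

theorem inner_kernelSection (x : ℝ) (v : Lp ℝ 2 μ) :
    inner ℝ (kernelSection μ x) v = ∫ y, projKernel μ x y * v y ∂μ := by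
  rw [L2.inner_def]
  refine integral_congr_ae ?_
  filter_upwards [(memLp_projKernel μ x).coeFn_toLp] with y hy
  rw [kernelSection, hy]
  simp [mul_comm]

theorem norm_sq_kernelSection (x : ℝ) :
    ‖kernelSection μ x‖ ^ 2 = ∫ y, projKernel μ x y ^ 2 ∂μ := by
  rw [norm_sq_eq_integral]
  refine integral_congr_ae ?_
  filter_upwards [(memLp_projKernel μ x).coeFn_toLp] with y hy
  rw [kernelSection, hy]

theorem norm_sq_kernelSection_le (x : ℝ) : ‖kernelSection μ x‖ ^ 2 ≤ 1 := by
  rw [norm_sq_kernelSection]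
  calc ∫ y, projKernel μ x y ^ 2 ∂μ ≤ ∫ _, (1 : ℝ) ∂μ := by
        refine integral_mono_of_nonneg (Eventually.of_forall fun y => sq_nonneg _)
          (integrable_const _) (Eventually.of_forall fun y => projKernel_sq_le_one μ x y)
    _ = 1 := by simp

theorem coeFn_opJ (v : Lp ℝ 2 μ) :
    opJ μ v =ᵐ[μ] fun x => inner ℝ (kernelSection μ x) v := by
  simp only [inner_kernelSection]
  exact (memLp_integral_projKernel μ v).coeFn_toLp

theorem memLp_inner_kernelSection (v : Lp ℝ 2 μ) :
    MemLp (fun x => inner ℝ (kernelSection μ x) v) 2 μ := by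
  simp only [inner_kernelSection]
  exact memLp_integral_projKernel μ v

theorem norm_sq_opJ (v : Lp ℝ 2 μ) :
    ‖opJ μ v‖ ^ 2 = ∫ x, inner ℝ (kernelSection μ x) v ^ 2 ∂μ := by
  rw [norm_sq_eq_integral]
  refine integral_congr_ae ?_
  filter_upwards [coeFn_opJ μ v] with x hx
  rw [hx]

/-- Bessel's inequality for the Hilbert-Schmidt norm of the kernel operator. -/
theorem sum_norm_sq_opJ_le {ι : Type*} {v : ι → Lp ℝ 2 μ} (hv : Orthonormal ℝ v)
    (s : Finset ι) : ∑ i ∈ s, ‖opJ μ (v i)‖ ^ 2 ≤ 1 := by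
  simp only [norm_sq_opJ]
  rw [← integral_finsetSum _ fun i _ => (memLp_inner_kernelSection μ (v i)).integrable_sq]
  calc ∫ x, ∑ i ∈ s, inner ℝ (kernelSection μ x) (v i) ^ 2 ∂μ ≤ ∫ _, (1 : ℝ) ∂μ := by
        refine integral_mono_of_nonneg
          (Eventually.of_forall fun y => Finset.sum_nonneg fun _ _ => sq_nonneg _)
          (integrable_const _) (Eventually.of_forall fun x => ?_)
        refine le_trans ?_ (norm_sq_kernelSection_le μ x)
        have := hv.sum_inner_products_le (s := s) (kernelSection μ x)
        simpa [real_inner_comm] using this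
    _ = 1 := by simp

theorem norm_opJ_le (v : Lp ℝ 2 μ) : ‖opJ μ v‖ ≤ 1 * ‖v‖ := by
  rw [one_mul]
  refine abs_le_of_sq_le_sq' ?_ (norm_nonneg _) |>.2
  rw [norm_sq_opJ]
  calc ∫ x, inner ℝ (kernelSection μ x) v ^ 2 ∂μ ≤ ∫ _, ‖v‖ ^ 2 ∂μ := by
        refine integral_mono_of_nonneg (Eventually.of_forall fun y => sq_nonneg _)
          (integrable_const _) (Eventually.of_forall fun x => ?_)
        have h1 := abs_real_inner_le_norm (kernelSection μ x) v
        have h2 := norm_sq_kernelSection_le μ x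
        have h3 : inner ℝ (kernelSection μ x) v ^ 2 ≤ (‖kernelSection μ x‖ * ‖v‖) ^ 2 := by
          rw [← sq_abs]
          exact pow_le_pow_left₀ (abs_nonneg _) h1 2
        refine h3.trans ?_
        rw [mul_pow]
        exact mul_le_of_le_one_left (sq_nonneg _) h2
    _ = ‖v‖ ^ 2 := by simp

/-- The kernel operator as a bounded operator. -/
def opJL : Lp ℝ 2 μ →L[ℝ] Lp ℝ 2 μ := (opJ μ).mkContinuous 1 (norm_opJ_le μ)

/-- Fubini, together with the symmetry of `φ_F`. -/
theorem isSymmetric_opJ : (opJ μ).IsSymmetric := by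
  intro u v
  have hu : Integrable u μ := (Lp.memLp u).integrable (by norm_num)
  have hv : Integrable v μ := (Lp.memLp v).integrable (by norm_num)
  have hint : Integrable (fun p : ℝ × ℝ => projKernel μ p.1 p.2 * (v p.1 * u p.2)) (μ.prod μ) :=
    (hv.mul_prod hu).bdd_mul (c := 1) (measurable_projKernel μ).aestronglyMeasurable
      (Eventually.of_forall fun p => abs_projKernel_le μ p.1 p.2)
  have h1 : inner ℝ (opJ μ u) v = ∫ x, ∫ y, projKernel μ x y * (v x * u y) ∂μ ∂μ := by
    rw [L2.inner_def]
    refine integral_congr_ae ?_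
    filter_upwards [coeFn_opJ μ u] with x hx
    rw [hx, inner_kernelSection]
    simp only [RCLike.inner_apply, conj_trivial]
    rw [← integral_const_mul]
    congr 1 with y
    ring
  have h2 : inner ℝ u (opJ μ v) = ∫ y, ∫ x, projKernel μ x y * (v x * u y) ∂μ ∂μ := by
    rw [L2.inner_def]
    refine integral_congr_ae ?_
    filter_upwards [coeFn_opJ μ v] with y hy
    rw [hy, inner_kernelSection]
    simp only [RCLike.inner_apply, conj_trivial]
    rw [← integral_mul_const]
    congr 1 with x
    rw [projKernel_comm]
    ring
  rw [h1, h2]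
  exact integral_integral_swap hint

theorem isCompactOperator_opJL : IsCompactOperator (opJL μ) := by
  obtain ⟨w, b, -⟩ := exists_hilbertBasis ℝ (Lp ℝ 2 μ)
  refine isCompactOperator_of_summable_norm_sq b (opJL μ) ?_
  exact summable_of_sum_le (fun _ => sq_nonneg _) fun s => sum_norm_sq_opJ_le μ b.orthonormal s

/-- Parseval for each section `φ_F(x, ·)`, integrated over `x`. Sum and integral may be exchanged
because the basis is countable. -/
theorem hasSum_norm_sq_opJ {ι : Type*} (b : HilbertBasis ι ℝ (Lp ℝ 2 μ)) :
    HasSum (fun i => ‖opJ μ (b i)‖ ^ 2) (∫ x, ∫ y, projKernel μ x y ^ 2 ∂μ ∂μ) := by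
  have : Fact ((2 : ENNReal) ≠ ⊤) := ⟨by norm_num⟩
  have : Countable ι := b.orthonormal.countable_index
  have hsum : Summable fun i => ‖opJ μ (b i)‖ ^ 2 :=
    summable_of_sum_le (fun _ => sq_nonneg _) fun s => sum_norm_sq_opJ_le μ b.orthonormal s
  have h := hasSum_integral_of_summable_integral_norm (μ := μ)
    (F := fun i x => inner ℝ (kernelSection μ x) (b i) ^ 2)
    (fun i => (memLp_inner_kernelSection μ (b i)).integrable_sq)
    (by simpa [norm_sq_opJ] using hsum)
  simp only [norm_sq_opJ]
  refine (congrArg (HasSum _) (integral_congr_ae (Eventually.of_forall fun x => ?_))).mpr h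
  rw [← norm_sq_kernelSection, ← real_inner_self_eq_norm_sq]
  rw [← b.tsum_inner_mul_inner]
  refine tsum_congr fun i => ?_
  rw [real_inner_comm (kernelSection μ x) (b i), pow_two]

end KernelOperator

/-- Orthonormal bases of the eigenspaces for nonzero eigenvalues form an orthonormal family. -/
theorem LinearMap.IsSymmetric.orthonormal_sigma_eigenspace {E : Type*} [NormedAddCommGroup E]
    [InnerProductSpace ℝ E] {T : E →ₗ[ℝ] E} (hT : T.IsSymmetric)
    {α : {r : ℝ // r ≠ 0} → Type*} [∀ r, Fintype (α r)]
    (b : ∀ r : {r : ℝ // r ≠ 0}, OrthonormalBasis (α r) ℝ (Module.End.eigenspace T (r : ℝ))) :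
    Orthonormal ℝ fun a : Σ r, α r => (b a.1 a.2 : E) := by
  have h := hT.orthogonalFamily_eigenspaces.comp (γ := {r : ℝ // r ≠ 0}) Subtype.val_injective
  exact h.orthonormal_sigma_orthonormal (v_family := fun r => b r) fun r => (b r).orthonormal

/-! ### Eigenvalue sequences and eigenvectors -/

section Eigenvalues

variable (μ : Measure ℝ) [IsProbabilityMeasure μ]

theorem finiteDimensional_eigenspace_opJ {r : ℝ} (hr : r ≠ 0) :
    FiniteDimensional ℝ (Module.End.eigenspace (opJ μ) r) :=
  (opJL μ).finite_dimensional_eigenspace (isCompactOperator_opJL μ) r hr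

theorem eq_zero_of_inner_eigenspace_opJ (u : Lp ℝ 2 μ)
    (h : ∀ r, ∀ w ∈ Module.End.eigenspace (opJ μ) r, inner ℝ w u = 0) : u = 0 := by
  have h1 := (opJL μ).orthogonalComplement_iSup_eigenspaces_eq_bot (isCompactOperator_opJL μ)
    (isSymmetric_opJ μ)
  rw [← Submodule.mem_bot ℝ, ← h1, ← Submodule.iInf_orthogonal, Submodule.mem_iInf]
  exact fun r => (Submodule.mem_orthogonal _ _).2 (h r)

theorem toENat_rank_eigenspace_opJ {r : ℝ} (hr : r ≠ 0) :
    Cardinal.toENat (Module.rank ℝ (Module.End.eigenspace (opJ μ) r)) =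
      (Module.finrank ℝ (Module.End.eigenspace (opJ μ) r) : ℕ∞) := by
  have := finiteDimensional_eigenspace_opJ μ hr
  rw [← Module.finrank_eq_rank]
  simp

theorem exists_isEigenvalueSeq_antitone :
    ∃ ν : ℕ → ℝ, IsEigenvalueSeq (opJ μ) ν ∧ Antitone (fun i => |ν i|) := by
  have hfd : ∀ r : {r : ℝ // r ≠ 0},
      FiniteDimensional ℝ (Module.End.eigenspace (opJ μ) (r : ℝ)) :=
    fun r => finiteDimensional_eigenspace_opJ μ r.2
  let b := fun r : {r : ℝ // r ≠ 0} =>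
    stdOrthonormalBasis ℝ (Module.End.eigenspace (opJ μ) (r : ℝ))
  have hb := (isSymmetric_opJ μ).orthonormal_sigma_eigenspace b
  let κ := Σ r : {r : ℝ // r ≠ 0}, Fin (Module.finrank ℝ (Module.End.eigenspace (opJ μ) (r : ℝ)))
  -- The summand `ℕ` supplies the padding zeros and makes the index type infinite, as the
  -- enumeration requires.
  let val : κ ⊕ ℕ → ℝ := Sum.elim (fun a => (a.1 : ℝ)) fun _ => 0
  have hfin : ∀ ε > 0, {j | ε ≤ |val j|}.Finite := by
    intro ε hε
    have hκ : {a : κ | ε ≤ |(a.1 : ℝ)|}.Finite := by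
      by_contra hinf
      -- More than `1 / ε ^ 2` orthonormal eigenvectors with eigenvalues of modulus at least `ε`
      -- would violate `sum_norm_sq_opJ_le`.
      obtain ⟨N, hN⟩ := exists_nat_gt (1 / ε ^ 2)
      obtain ⟨t, ht, hcard⟩ := Set.Infinite.exists_subset_card_eq hinf N
      have h1 := sum_norm_sq_opJ_le μ hb t
      have h2 : (N : ℝ) * ε ^ 2 ≤ ∑ a ∈ t, ‖opJ μ (b a.1 a.2 : Lp ℝ 2 μ)‖ ^ 2 := by
        rw [← hcard, ← nsmul_eq_mul]
        refine Finset.card_nsmul_le_sum _ _ _ fun a ha => ?_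
        rw [Module.End.mem_eigenspace_iff.1 (b a.1 a.2).2, norm_smul, hb.1 a, mul_one]
        exact pow_le_pow_left₀ hε.le (ht ha) 2
      rw [div_lt_iff₀ (by positivity)] at hN
      linarith
    refine (hκ.image Sum.inl).subset ?_
    rintro (a | n) hj
    · exact ⟨a, hj, rfl⟩
    · simp [val] at hj
      linarith
  obtain ⟨a, ha, hanti, hrange⟩ := exists_antitone_enumeration (fun j => |val j|)
    (fun _ => abs_nonneg _) hfin
  refine ⟨fun n => val (a n), fun r hr => ?_, hanti⟩
  rw [toENat_rank_eigenspace_opJ μ hr]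
  have hpre : {i | val (a i) = r} = a ⁻¹' {j | val j = r} := rfl
  rw [hpre, Set.encard_preimage_of_injective_subset_range ha]
  · have himg : {j | val j = r} =
        Set.range fun k : Fin (Module.finrank ℝ (Module.End.eigenspace (opJ μ) r)) =>
          (Sum.inl ⟨⟨r, hr⟩, k⟩ : κ ⊕ ℕ) := by
      ext j
      constructor
      · rintro hj
        rcases j with ⟨⟨s, hs⟩, k⟩ | n
        · obtain rfl : s = r := hj
          exact ⟨k, rfl⟩
        · exact absurd hj.symm hr
      · rintro ⟨k, rfl⟩
        rfl
    rw [himg, ← Set.image_univ, Function.Injective.encard_image]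
    · simp
    · intro k l h
      exact eq_of_heq (Sigma.mk.inj (Sum.inl_injective h)).2
  · intro j hj
    refine hrange j ?_
    rw [show val j = r from hj]
    exact abs_pos.2 hr

variable {μ} {ν : ℕ → ℝ}

/-- A complete orthonormal family of eigenvectors along a sequence of eigenvalues. -/
theorem IsEigenvalueSeq.exists_orthonormal (hν : IsEigenvalueSeq (opJ μ) ν) :
    ∃ e : {i // ν i ≠ 0} → Lp ℝ 2 μ, Orthonormal ℝ e ∧ (∀ i, opJ μ (e i) = ν i • e i) ∧
      ∀ v, (∀ i, inner ℝ (e i) v = 0) → opJ μ v = 0 := by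
  have hfd : ∀ r : {r : ℝ // r ≠ 0},
      FiniteDimensional ℝ (Module.End.eigenspace (opJ μ) (r : ℝ)) :=
    fun r => finiteDimensional_eigenspace_opJ μ r.2
  have hcard : ∀ r : {r : ℝ // r ≠ 0}, {i | ν i = r}.encard =
      (Module.finrank ℝ (Module.End.eigenspace (opJ μ) (r : ℝ)) : ℕ∞) :=
    fun r => (hν r r.2).trans (toENat_rank_eigenspace_opJ μ r.2)
  have hfin : ∀ r : {r : ℝ // r ≠ 0}, Finite {i // ν i = r} := fun r =>
    Set.finite_of_encard_eq_coe (hcard r)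
  let hft : ∀ r : {r : ℝ // r ≠ 0}, Fintype {i // ν i = r} := fun r => Fintype.ofFinite _
  have hequiv : ∀ r : {r : ℝ // r ≠ 0}, Nonempty
      (Fin (Module.finrank ℝ (Module.End.eigenspace (opJ μ) (r : ℝ))) ≃ {i // ν i = r}) := by
    intro r
    refine ⟨(Finite.equivFinOfCardEq ?_).symm⟩
    have := hcard r
    have h2 : {i | ν i = (r : ℝ)}.ncard =
      Module.finrank ℝ (Module.End.eigenspace (opJ μ) (r : ℝ)) := by
      rw [Set.ncard_def, this]; rfl
    rw [← h2]
    exact Nat.card_coe_set_eq _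
  -- The fibre of `ν` over `r` has as many elements as the eigenspace has dimensions, so it can
  -- index an orthonormal basis; `e i` is then the vector with index `i` over `r = ν i`.
  let b := fun r : {r : ℝ // r ≠ 0} =>
    (stdOrthonormalBasis ℝ (Module.End.eigenspace (opJ μ) (r : ℝ))).reindex (hequiv r).some
  have hb := (isSymmetric_opJ μ).orthonormal_sigma_eigenspace b
  refine ⟨fun i => (b ⟨ν i, i.2⟩ ⟨i, rfl⟩ : Lp ℝ 2 μ), ?_, ?_, ?_⟩
  · refine hb.comp (fun i : {i // ν i ≠ 0} => ⟨⟨ν i, i.2⟩, ⟨i, rfl⟩⟩) fun i j hij => ?_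
    have := congrArg (fun a : (Σ r : {r : ℝ // r ≠ 0}, {i // ν i = r}) => (a.2 : ℕ)) hij
    exact Subtype.ext this
  · intro i
    exact Module.End.mem_eigenspace_iff.1 (b ⟨ν i, i.2⟩ ⟨i, rfl⟩).2
  · intro v hv
    have hv' : ∀ r (hr : r ≠ 0), ∀ w ∈ Module.End.eigenspace (opJ μ) r, inner ℝ w v = 0 := by
      intro r hr w hw
      have := (b ⟨r, hr⟩).sum_repr ⟨w, hw⟩
      have hw' : w = ∑ i, (b ⟨r, hr⟩).repr ⟨w, hw⟩ i • (b ⟨r, hr⟩ i : Lp ℝ 2 μ) := by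
        have h2 := congrArg (Submodule.subtype _) this
        simpa using h2.symm
      rw [hw', sum_inner]
      refine Finset.sum_eq_zero fun i _ => ?_
      obtain ⟨i, hi⟩ := i
      have hvi := hv ⟨i, hi.symm ▸ hr⟩
      -- The eigenvalue is a free variable `s` here, so that `ν i = s` can be eliminated despite the
      -- dependent types.
      have key : ∀ (s : ℝ) (hs : s ≠ 0) (h1 : ν i = s) (h2 : ν i ≠ 0),
          (b ⟨s, hs⟩ ⟨i, h1⟩ : Lp ℝ 2 μ) = b ⟨ν i, h2⟩ ⟨i, rfl⟩ := by
        rintro s hs rfl h2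
        rfl
      rw [inner_smul_left, key r hr hi (hi.symm ▸ hr), hvi, mul_zero]
    -- By symmetry `⟨w, J v⟩ = r ⟨w, v⟩` on the eigenspace of `r`: this is zero by the factor when
    -- `r = 0` and by `hv'` otherwise.
    refine eq_zero_of_inner_eigenspace_opJ μ _ fun r w hw => ?_
    rw [← isSymmetric_opJ μ, Module.End.mem_eigenspace_iff.1 hw, inner_smul_left]
    by_cases hr : r = 0
    · simp [hr]
    · rw [hv' r hr w hw, mul_zero]

/-- The squares of the eigenvalues sum up to the squared Hilbert-Schmidt norm. -/
theorem IsEigenvalueSeq.hasSum_sq (hν : IsEigenvalueSeq (opJ μ) ν) :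
    HasSum (fun i => ν i ^ 2) (∫ x, ∫ y, projKernel μ x y ^ 2 ∂μ ∂μ) := by
  obtain ⟨e, he, hJe, hker⟩ := hν.exists_orthonormal
  -- The vectors added to `e` to form a Hilbert basis lie in the kernel of the operator and
  -- contribute nothing to its Hilbert-Schmidt norm.
  obtain ⟨w, b, hw, hbw⟩ := he.toSubtypeRange.exists_hilbertBasis_extension
  have h := hasSum_norm_sq_opJ μ b
  let g : {i // ν i ≠ 0} → w := fun i => ⟨e i, hw ⟨i, rfl⟩⟩
  have hg : Function.Injective g := fun i j hij =>
    he.linearIndependent.injective (congrArg Subtype.val hij)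
  have hb := b.orthonormal
  rw [hbw] at h hb
  rw [← hg.hasSum_iff] at h
  · have h2 : ((fun i : w => ‖opJ μ (i : Lp ℝ 2 μ)‖ ^ 2) ∘ g) =
        (fun i => ν i ^ 2) ∘ (Subtype.val : {i // ν i ≠ 0} → ℕ) := by
      ext i
      simp [g, hJe, norm_smul, he.1 i]
    rw [h2, Subtype.val_injective.hasSum_iff] at h
    · exact h
    · intro i hi
      by_contra h0
      exact hi ⟨⟨i, fun h => h0 (by simp [h])⟩, rfl⟩
  · intro x hx
    rw [hker x fun i => ?_]
    · simp
    · exact hb.2 (i := g i) (j := x) fun h => hx ⟨i, h⟩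

end Eigenvalues

/-! ### Second moments of degenerate U-statistics -/

section Orthogonality

variable {Ω : Type*} [MeasurableSpace Ω] {P : Measure Ω}

theorem integral_sq_sum_of_orthogonal {ι : Type*} (s : Finset ι) (Z : ι → Ω → ℝ)
    (hZ : ∀ i ∈ s, MemLp (Z i) 2 P)
    (h : ∀ i ∈ s, ∀ j ∈ s, i ≠ j → ∫ ω, Z i ω * Z j ω ∂P = 0) :
    ∫ ω, (∑ i ∈ s, Z i ω) ^ 2 ∂P = ∑ i ∈ s, ∫ ω, Z i ω ^ 2 ∂P := by
  classical
  have hint : ∀ i ∈ s, ∀ j ∈ s, Integrable (fun ω => Z i ω * Z j ω) P := fun i hi j hj =>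
    (hZ i hi).integrable_mul (hZ j hj)
  simp only [pow_two, Finset.sum_mul_sum]
  rw [integral_finsetSum _ fun i hi => integrable_finsetSum _ fun j hj => hint i hi j hj]
  refine Finset.sum_congr rfl fun i hi => ?_
  rw [integral_finsetSum _ fun j hj => hint i hi j hj]
  exact Finset.sum_eq_single_of_mem i hi fun j hj hji => h i hi j hj hji.symm

variable [IsProbabilityMeasure P] {X : ℕ → Ω → ℝ} {μ : Measure ℝ}

theorem map_pair_eq_prod (hX : ∀ i, Measurable (X i)) (hind : iIndepFun X P)
    (hlaw : ∀ i, P.map (X i) = μ) {i j : ℕ} (hij : i ≠ j) :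
    P.map (fun ω => (X i ω, X j ω)) = μ.prod μ := by
  rw [(indepFun_iff_map_prod_eq_prod_map_map (hX i).aemeasurable (hX j).aemeasurable).1
    (hind.indepFun hij), hlaw, hlaw]

variable [IsProbabilityMeasure μ]

/-- Independence from an infinite family reduces to finite subfamilies. It serves to integrate out
one coordinate with all others fixed. -/
theorem indepFun_compl_process (hX : ∀ i, Measurable (X i)) (hind : iIndepFun X P) (l : ℕ) :
    IndepFun (X l) (fun ω (i : {i // i ≠ l}) => X i ω) P := by
  refine IndepFun.indepFun_process (hX l) (fun i => hX i) fun I => ?_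
  have h := hind.indepFun_finset {l} (I.map (Function.Embedding.subtype _)) (by
    simp) hX
  refine h.comp (φ := fun x : ({l} : Finset ℕ) → ℝ => x ⟨l, by simp⟩)
    (ψ := fun (y : (I.map (Function.Embedding.subtype _)) → ℝ) (i : I) =>
      y ⟨i.1.1, Finset.mem_map_of_mem _ i.2⟩) (by fun_prop) (by fun_prop)

/-- If the mean over one coordinate vanishes identically, so does the mean. -/
theorem integral_comp_eq_zero_of_update (hX : ∀ i, Measurable (X i)) (hind : iIndepFun X P)
    (hlaw : ∀ i, P.map (X i) = μ) (l : ℕ) (f : (ℕ → ℝ) → ℝ) (hf : Measurable f)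
    (h0 : ∀ y : ℕ → ℝ, ∫ x, f (Function.update y l x) ∂μ = 0) :
    ∫ ω, f (fun i => X i ω) ∂P = 0 := by
  classical
  let ext : ℝ × ({i // i ≠ l} → ℝ) → ℕ → ℝ := fun p i => if h : i = l then p.1 else p.2 ⟨i, h⟩
  have hext : Measurable ext := by
    refine measurable_pi_lambda _ fun i => ?_
    by_cases h : i = l
    · simpa [ext, h] using measurable_fst
    · simp only [ext, h, dite_false]
      fun_prop
  have hY : Measurable (fun ω (i : {i // i ≠ l}) => X i ω) := by fun_prop
  have hXe : (fun ω => f (fun i => X i ω)) =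
      fun ω => (f ∘ ext) (X l ω, fun i : {i // i ≠ l} => X i ω) := by
    ext ω
    refine congrArg f (funext fun i => ?_)
    by_cases h : i = l
    · simp [ext, h]
    · simp [ext, h]
  have hpair := (indepFun_iff_map_prod_eq_prod_map_map (hX l).aemeasurable hY.aemeasurable).1
    (indepFun_compl_process hX hind l)
  have hprob : IsProbabilityMeasure (P.map (fun ω (i : {i // i ≠ l}) => X i ω)) :=
    Measure.isProbabilityMeasure_map hY.aemeasurable
  rw [hXe, ← integral_map (φ := fun ω => (X l ω, fun i : {i // i ≠ l} => X i ω))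
    ((hX l).prodMk hY).aemeasurable (hf.comp hext).aestronglyMeasurable, hpair, hlaw]
  -- Without integrability the integral is zero by convention, so Fubini is needed only in the first
  -- case.
  by_cases hint : Integrable (f ∘ ext) (μ.prod (P.map (fun ω (i : {i // i ≠ l}) => X i ω)))
  · rw [integral_prod_symm _ hint]
    refine integral_eq_zero_of_ae (Eventually.of_forall fun y => ?_)
    rw [Pi.zero_apply, ← h0 (ext (0, y))]
    refine integral_congr_ae (Eventually.of_forall fun x => congrArg f (funext fun i => ?_))
    by_cases h : i = l
    · simp [ext, h]
    · simp [ext, h]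
  · exact integral_undef hint

/-- Index set of the pairs `j < k < n`. -/
def pairIndices (n : ℕ) : Finset (Σ _ : ℕ, ℕ) := (Finset.range n).sigma fun k => Finset.range k

/-- Index set of the triples `i < j < k < n`. -/
def tripleIndices (n : ℕ) : Finset (Σ _ : ℕ, Σ _ : ℕ, ℕ) :=
  (Finset.range n).sigma fun k => pairIndices k

theorem mem_pairIndices {n : ℕ} {a : Σ _ : ℕ, ℕ} :
    a ∈ pairIndices n ↔ a.1 < n ∧ a.2 < a.1 := by
  simp [pairIndices]

theorem mem_tripleIndices {n : ℕ} {a : Σ _ : ℕ, Σ _ : ℕ, ℕ} :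
    a ∈ tripleIndices n ↔ a.1 < n ∧ a.2.1 < a.1 ∧ a.2.2 < a.2.1 := by
  simp [tripleIndices, mem_pairIndices]

theorem card_pairIndices_le (n : ℕ) : (pairIndices n).card ≤ n ^ 2 := by
  rw [pairIndices, Finset.card_sigma, pow_two]
  refine (Finset.sum_le_card_nsmul _ _ n fun k hk => ?_).trans (by simp)
  simpa using (Finset.mem_range.1 hk).le

theorem card_tripleIndices_le (n : ℕ) : (tripleIndices n).card ≤ n ^ 3 := by
  rw [tripleIndices, Finset.card_sigma, pow_succ']
  refine (Finset.sum_le_card_nsmul _ _ (n ^ 2) fun k hk => ?_).trans (by simp)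
  exact (card_pairIndices_le k).trans (Nat.pow_le_pow_left (Finset.mem_range.1 hk).le 2)

/-- Second moment of a degenerate U-statistic of order two. -/
theorem integral_sq_sum_pairs_le (hX : ∀ i, Measurable (X i)) (hind : iIndepFun X P)
    (hlaw : ∀ i, P.map (X i) = μ) (q : ℝ × ℝ → ℝ) (hq : Measurable q)
    (hq2 : MemLp q 2 (μ.prod μ)) (h1 : ∀ y, ∫ x, q (x, y) ∂μ = 0)
    (h2 : ∀ x, ∫ y, q (x, y) ∂μ = 0) (n : ℕ) :
    MemLp (fun ω => ∑ k ∈ Finset.range n, ∑ j ∈ Finset.range k, q (X j ω, X k ω)) 2 P ∧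
    ∫ ω, (∑ k ∈ Finset.range n, ∑ j ∈ Finset.range k, q (X j ω, X k ω)) ^ 2 ∂P ≤
      (n : ℝ) ^ 2 * ∫ p, q p ^ 2 ∂(μ.prod μ) := by
  have hpair : ∀ a ∈ pairIndices n, P.map (fun ω => (X a.2 ω, X a.1 ω)) = μ.prod μ :=
    fun a ha => map_pair_eq_prod hX hind hlaw (mem_pairIndices.1 ha).2.ne
  have hmeas : ∀ a : Σ _ : ℕ, ℕ, Measurable (fun ω => (X a.2 ω, X a.1 ω)) :=
    fun a => (hX _).prodMk (hX _)
  have hL2 : ∀ a ∈ pairIndices n, MemLp (fun ω => q (X a.2 ω, X a.1 ω)) 2 P := by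
    intro a ha
    refine (memLp_map_measure_iff hq.aestronglyMeasurable (hmeas a).aemeasurable).1 ?_
    rwa [hpair a ha]
  simp only [Finset.sum_sigma' (Finset.range n) (fun k => Finset.range k), ← pairIndices.eq_1]
  refine ⟨memLp_finsetSum _ hL2, ?_⟩
  rw [integral_sq_sum_of_orthogonal _ _ hL2]
  · have : ∀ a ∈ pairIndices n, ∫ ω, q (X a.2 ω, X a.1 ω) ^ 2 ∂P = ∫ p, q p ^ 2 ∂(μ.prod μ) := by
      intro a ha
      rw [← hpair a ha, integral_map (hmeas a).aemeasurable
        (hq.pow_const 2).aestronglyMeasurable]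
    rw [Finset.sum_congr rfl this, Finset.sum_const, nsmul_eq_mul]
    refine mul_le_mul_of_nonneg_right ?_ (integral_nonneg fun _ => sq_nonneg _)
    exact_mod_cast card_pairIndices_le n
  · rintro ⟨k, j⟩ ha ⟨k', j'⟩ hb hne
    rw [mem_pairIndices] at ha hb
    dsimp only at ha hb ⊢
    have hm : Measurable fun x : ℕ → ℝ => q (x j, x k) * q (x j', x k') := by fun_prop
    -- Two different increasing pairs cannot contain each other: some index of the first is absent
    -- from the second, and integrating over it kills the product.
    have hcase : (k ≠ k' ∧ k ≠ j') ∨ (j ≠ k' ∧ j ≠ j') := by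
      by_contra hcon
      have : k = k' ∧ j = j' := by omega
      exact hne (by rw [this.1, this.2])
    rcases hcase with ⟨hk1, hk2⟩ | ⟨hj1, hj2⟩
    · refine integral_comp_eq_zero_of_update hX hind hlaw k _ hm fun y => ?_
      simp only [Function.update_self, Function.update_of_ne hk1.symm,
        Function.update_of_ne hk2.symm, Function.update_of_ne ha.2.ne]
      rw [integral_mul_const, h2, zero_mul]
    · refine integral_comp_eq_zero_of_update hX hind hlaw j _ hm fun y => ?_
      simp only [Function.update_self, Function.update_of_ne hj1.symm,
        Function.update_of_ne hj2.symm, Function.update_of_ne ha.2.ne']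
      rw [integral_mul_const, h1, zero_mul]

/-- Second moment of a bounded degenerate U-statistic of order three. -/
theorem integral_sq_sum_triples_le (hX : ∀ i, Measurable (X i)) (hind : iIndepFun X P)
    (hlaw : ∀ i, P.map (X i) = μ) (q : ℝ × ℝ × ℝ → ℝ) (hq : Measurable q) {C : ℝ}
    (hC : ∀ p, |q p| ≤ C) (h1 : ∀ y z, ∫ x, q (x, y, z) ∂μ = 0)
    (h2 : ∀ x z, ∫ y, q (x, y, z) ∂μ = 0) (h3 : ∀ x y, ∫ z, q (x, y, z) ∂μ = 0) (n : ℕ) :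
    MemLp (fun ω => ∑ k ∈ Finset.range n, ∑ j ∈ Finset.range k, ∑ i ∈ Finset.range j,
      q (X i ω, X j ω, X k ω)) 2 P ∧
    ∫ ω, (∑ k ∈ Finset.range n, ∑ j ∈ Finset.range k, ∑ i ∈ Finset.range j,
      q (X i ω, X j ω, X k ω)) ^ 2 ∂P ≤ (n : ℝ) ^ 3 * C ^ 2 := by
  have hmeas : ∀ a : Σ _ : ℕ, Σ _ : ℕ, ℕ,
      Measurable (fun ω => q (X a.2.2 ω, X a.2.1 ω, X a.1 ω)) :=
    fun a => hq.comp ((hX _).prodMk ((hX _).prodMk (hX _)))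
  have hL2 : ∀ a ∈ tripleIndices n, MemLp (fun ω => q (X a.2.2 ω, X a.2.1 ω, X a.1 ω)) 2 P :=
    fun a _ => MemLp.of_bound (hmeas a).aestronglyMeasurable C (Eventually.of_forall fun ω => hC _)
  have hsum : ∀ F : ℕ → ℕ → ℕ → ℝ, ∑ k ∈ Finset.range n, ∑ j ∈ Finset.range k,
      ∑ i ∈ Finset.range j, F i j k = ∑ a ∈ tripleIndices n, F a.2.2 a.2.1 a.1 := by
    intro F
    rw [tripleIndices, Finset.sum_sigma]
    refine Finset.sum_congr rfl fun k _ => ?_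
    rw [pairIndices, Finset.sum_sigma]
  simp only [fun ω => hsum fun i j k => q (X i ω, X j ω, X k ω)]
  refine ⟨memLp_finsetSum _ hL2, ?_⟩
  rw [integral_sq_sum_of_orthogonal _ _ hL2]
  · have hle : ∀ a ∈ tripleIndices n,
        ∫ ω, q (X a.2.2 ω, X a.2.1 ω, X a.1 ω) ^ 2 ∂P ≤ C ^ 2 := by
      intro a _
      calc ∫ ω, q (X a.2.2 ω, X a.2.1 ω, X a.1 ω) ^ 2 ∂P ≤ ∫ _, C ^ 2 ∂P := by
            refine integral_mono_of_nonneg (Eventually.of_forall fun _ => sq_nonneg _)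
              (integrable_const _) (Eventually.of_forall fun ω => ?_)
            dsimp only
            rw [← sq_abs]
            exact pow_le_pow_left₀ (abs_nonneg _) (hC _) 2
        _ = C ^ 2 := by simp
    refine (Finset.sum_le_card_nsmul _ _ _ hle).trans ?_
    rw [nsmul_eq_mul]
    refine mul_le_mul_of_nonneg_right ?_ (sq_nonneg _)
    exact_mod_cast card_tripleIndices_le n
  · rintro ⟨k, j, i⟩ ha ⟨k', j', i'⟩ hb hne
    rw [mem_tripleIndices] at ha hb
    dsimp only at ha hb ⊢
    have hm : Measurable fun x : ℕ → ℝ => q (x i, x j, x k) * q (x i', x j', x k') := by fun_prop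
    have hji := ha.2.2
    have hkj := ha.2.1
    have hki := hji.trans hkj
    -- As for pairs: increasing triples that differ leave some index of the first outside the
    -- second.
    have hcase : (k ≠ k' ∧ k ≠ j' ∧ k ≠ i') ∨ (j ≠ k' ∧ j ≠ j' ∧ j ≠ i') ∨
        (i ≠ k' ∧ i ≠ j' ∧ i ≠ i') := by
      by_contra hcon
      have : k = k' ∧ j = j' ∧ i = i' := by omega
      exact hne (by rw [this.1, this.2.1, this.2.2])
    rcases hcase with ⟨hk1, hk2, hk3⟩ | ⟨hj1, hj2, hj3⟩ | ⟨hi1, hi2, hi3⟩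
    · refine integral_comp_eq_zero_of_update hX hind hlaw k _ hm fun y => ?_
      simp only [Function.update_self, Function.update_of_ne hk1.symm,
        Function.update_of_ne hk2.symm, Function.update_of_ne hk3.symm,
        Function.update_of_ne hkj.ne, Function.update_of_ne hki.ne]
      rw [integral_mul_const, h3, zero_mul]
    · refine integral_comp_eq_zero_of_update hX hind hlaw j _ hm fun y => ?_
      simp only [Function.update_self, Function.update_of_ne hj1.symm,
        Function.update_of_ne hj2.symm, Function.update_of_ne hj3.symm,
        Function.update_of_ne hkj.ne', Function.update_of_ne hji.ne]
      rw [integral_mul_const, h2, zero_mul]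
    · refine integral_comp_eq_zero_of_update hX hind hlaw i _ hm fun y => ?_
      simp only [Function.update_self, Function.update_of_ne hi1.symm,
        Function.update_of_ne hi2.symm, Function.update_of_ne hi3.symm,
        Function.update_of_ne hki.ne', Function.update_of_ne hji.ne']
      rw [integral_mul_const, h1, zero_mul]

end Orthogonality

/-! ### The kernel `Φ` -/

section Kernel

theorem ind_nonneg (p : Prop) : 0 ≤ ind p := by
  unfold ind; split_ifs <;> norm_num

theorem ind_le_one (p : Prop) : ind p ≤ 1 := by
  unfold ind; split_ifs <;> norm_num

theorem ind_eq_indicator {α : Type*} (p : α → Prop) :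
    (fun x => ind (p x)) = Set.indicator {x | p x} 1 := by
  classical
  ext x
  by_cases h : p x
  · rw [Set.indicator_of_mem (show x ∈ {x | p x} from h)]
    simp [ind, h]
  · rw [Set.indicator_of_notMem (show x ∉ {x | p x} from h)]
    simp [ind, h]

/-- The summand of the kernel `Φ` for a fixed order of the arguments. -/
def kernelTerm (x y z : ℝ) : ℝ := ind (|x - y| < |z|) - ind (|x + y| < |z|)

theorem abs_kernelTerm_le (x y z : ℝ) : |kernelTerm x y z| ≤ 1 := by
  have h1 := ind_nonneg (|x - y| < |z|)
  have h2 := ind_nonneg (|x + y| < |z|)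
  have h3 := ind_le_one (|x - y| < |z|)
  have h4 := ind_le_one (|x + y| < |z|)
  unfold kernelTerm
  rw [abs_le]
  constructor <;> linarith

theorem kernelTerm_comm (x y z : ℝ) : kernelTerm x y z = kernelTerm y x z := by
  unfold kernelTerm
  rw [abs_sub_comm, add_comm]

theorem kernelTerm_neg (x y z : ℝ) : kernelTerm (-x) y z = -kernelTerm x y z := by
  unfold kernelTerm
  rw [show -x - y = -(x + y) by ring, show -x + y = -(x - y) by ring, abs_neg, abs_neg]
  ring

theorem measurable_kernelTerm : Measurable fun p : ℝ × ℝ × ℝ => kernelTerm p.1 p.2.1 p.2.2 := by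
  refine Measurable.sub ?_ ?_
  · rw [ind_eq_indicator]
    exact measurable_one.indicator (measurableSet_lt (by fun_prop) (by fun_prop))
  · rw [ind_eq_indicator]
    exact measurable_one.indicator (measurableSet_lt (by fun_prop) (by fun_prop))

/-- The six permutations pair up, because each term is symmetric in its first two arguments. -/
theorem kernelPhi_eq (x y z : ℝ) :
    kernelPhi ![x, y, z] =
      (kernelTerm x y z + kernelTerm x z y + kernelTerm y z x) / 3 := by
  have huniv : (Finset.univ : Finset (Equiv.Perm (Fin 3))) =
      {1, Equiv.swap 0 1, Equiv.swap 0 2, Equiv.swap 1 2, finRotate 3, (finRotate 3)⁻¹} := by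
    decide
  have h6 : ((Nat.factorial 3 : ℕ) : ℝ)⁻¹ = 1 / 6 := by norm_num [Nat.factorial]
  have hterm : ∀ a b c : ℝ, ind (|a - b| < |c|) - ind (|a + b| < |c|) = kernelTerm a b c :=
    fun _ _ _ => rfl
  unfold kernelPhi
  rw [huniv, h6]
  rw [Finset.sum_insert (by decide), Finset.sum_insert (by decide), Finset.sum_insert (by decide),
    Finset.sum_insert (by decide), Finset.sum_insert (by decide), Finset.sum_singleton]
  simp only [hterm]
  have e1 : Equiv.swap (0 : Fin 3) 1 2 = 2 := by decide
  have e2 : Equiv.swap (0 : Fin 3) 2 1 = 1 := by decide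
  have e3 : Equiv.swap (1 : Fin 3) 2 0 = 0 := by decide
  have f0 : finRotate 3 0 = 1 := by decide
  have f1 : finRotate 3 1 = 2 := by decide
  have f2 : finRotate 3 2 = 0 := by decide
  have g0 : (finRotate 3)⁻¹ 0 = 2 := by decide
  have g1 : (finRotate 3)⁻¹ 1 = 0 := by decide
  have g2 : (finRotate 3)⁻¹ 2 = 1 := by decide
  simp only [Equiv.swap_apply_left, Equiv.swap_apply_right, e1, e2, e3, f0, f1, f2, g0, g1, g2,
    Equiv.Perm.one_apply, Matrix.cons_val]
  rw [kernelTerm_comm y x z, kernelTerm_comm z y x, kernelTerm_comm z x y]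
  ring

end Kernel

/-! ### Consequences of the symmetry hypothesis -/

section Symmetry

variable {μ : Measure ℝ}

theorem integral_comp_neg_of_map_eq (hneg : μ.map (fun x => -x) = μ) (f : ℝ → ℝ) :
    ∫ x, f (-x) ∂μ = ∫ x, f x ∂μ := by
  conv_rhs => rw [← hneg]
  exact (integral_map_equiv (MeasurableEquiv.neg ℝ) f).symm

theorem integral_eq_zero_of_odd (hneg : μ.map (fun x => -x) = μ) {f : ℝ → ℝ}
    (hf : ∀ x, f (-x) = -f x) : ∫ x, f x ∂μ = 0 := by
  have h := integral_comp_neg_of_map_eq hneg f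
  simp only [hf, integral_neg] at h
  linarith

theorem projKernel_neg (s t : ℝ) : projKernel μ (-s) t = -projKernel μ s t := by
  unfold projKernel
  rw [show -s - t = -(s + t) by ring, show -s + t = -(s - t) by ring, abs_neg, abs_neg]
  ring

theorem integral_projKernel_left (hneg : μ.map (fun x => -x) = μ) (y : ℝ) :
    ∫ x, projKernel μ x y ∂μ = 0 :=
  integral_eq_zero_of_odd hneg fun x => projKernel_neg x y

variable [IsProbabilityMeasure μ]

theorem nullSingletonClass_of_continuous_cdf (hcont : Continuous (cdf μ)) : NullSingletonClass μ := by
  refine ⟨fun x => ?_⟩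
  rw [← measure_cdf μ, StieltjesFunction.measure_singleton,
    hcont.continuousAt.continuousWithinAt.leftLim_eq]
  simp

theorem measureReal_Ioi (x : ℝ) : μ.real (Set.Ioi x) = 1 - cdf μ x := by
  rw [cdf_eq_real, ← Set.compl_Iic, measureReal_compl measurableSet_Iic]
  simp

/-- The reflected law has distribution function `μ [-x, ∞)`; without atoms this is `1 - F(-x) =
F(x)`. -/
theorem map_neg_eq_self (hcont : Continuous (cdf μ))
    (hH₀ : ∀ x : ℝ, 1 - cdf μ x - cdf μ (-x) = 0) : μ.map (fun x => -x) = μ := by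
  have := nullSingletonClass_of_continuous_cdf hcont
  have : IsProbabilityMeasure (μ.map fun x => -x) :=
    Measure.isProbabilityMeasure_map measurable_neg.aemeasurable
  refine Measure.eq_of_cdf _ _ ?_
  ext x
  rw [cdf_eq_real, map_measureReal_apply measurable_neg measurableSet_Iic]
  have hpre : (fun x : ℝ => -x) ⁻¹' Set.Iic x = Set.Ici (-x) := by
    ext y; simp
  rw [hpre, measureReal_congr Ioi_ae_eq_Ici.symm, measureReal_Ioi]
  linarith [hH₀ x]

theorem integral_ind_lt_abs (hcont : Continuous (cdf μ))
    (hH₀ : ∀ x : ℝ, 1 - cdf μ x - cdf μ (-x) = 0) {a : ℝ} (ha : 0 ≤ a) :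
    ∫ x, ind (a < |x|) ∂μ = 2 * (1 - cdf μ a) := by
  have := nullSingletonClass_of_continuous_cdf hcont
  have hset : {x : ℝ | a < |x|} = Set.Ioi a ∪ Set.Iio (-a) := by
    ext x
    simp only [Set.mem_ofPred_eq, Set.mem_union, Set.mem_Ioi, Set.mem_Iio, lt_abs]
    constructor <;> (rintro (h | h) <;> [left; right] <;> linarith)
  have hm : MeasurableSet {x : ℝ | a < |x|} := measurableSet_lt (by fun_prop) (by fun_prop)
  rw [ind_eq_indicator, integral_indicator_one hm, hset, measureReal_union _ measurableSet_Iio,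
    measureReal_Ioi, measureReal_congr Iio_ae_eq_Iic, ← cdf_eq_real]
  · linarith [hH₀ a]
  · rw [Set.disjoint_left]
    intro x hx hx'
    simp only [Set.mem_Ioi, Set.mem_Iio] at hx hx'
    linarith

theorem measurable_kernelTerm_comp {α : Type*} [MeasurableSpace α] {f g h : α → ℝ}
    (hf : Measurable f) (hg : Measurable g) (hh : Measurable h) :
    Measurable fun x => kernelTerm (f x) (g x) (h x) :=
  measurable_kernelTerm.comp (hf.prodMk (hg.prodMk hh))

theorem integrable_kernelTerm_comp {f g h : ℝ → ℝ}
    (hf : Measurable f) (hg : Measurable g) (hh : Measurable h) :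
    Integrable (fun x => kernelTerm (f x) (g x) (h x)) μ :=
  Integrable.of_bound (measurable_kernelTerm_comp hf hg hh).aestronglyMeasurable 1
    (Eventually.of_forall fun _ => abs_kernelTerm_le _ _ _)

/-- This is where `φ_F` comes from: `|X|` exceeds `a ≥ 0` with probability `2 (1 - F(a))`, applied
at `|y - z|` and `|y + z|`. -/
theorem integral_kernelTerm (hcont : Continuous (cdf μ))
    (hH₀ : ∀ x : ℝ, 1 - cdf μ x - cdf μ (-x) = 0) (y z : ℝ) :
    ∫ x, kernelTerm y z x ∂μ = 3 * projKernel μ y z := by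
  have hint : ∀ a : ℝ, Integrable (fun x => ind (a < |x|)) μ := by
    intro a
    rw [ind_eq_indicator]
    exact (integrable_const _).indicator (measurableSet_lt (by fun_prop) (by fun_prop))
  unfold kernelTerm
  rw [integral_sub (hint _) (hint _), integral_ind_lt_abs hcont hH₀ (abs_nonneg _),
    integral_ind_lt_abs hcont hH₀ (abs_nonneg _)]
  unfold projKernel
  ring

/-- The part of the kernel `Φ` that is degenerate of order three. -/
def degenerateKernel (μ : Measure ℝ) (p : ℝ × ℝ × ℝ) : ℝ :=
  kernelPhi ![p.1, p.2.1, p.2.2] - projKernel μ p.1 p.2.1 - projKernel μ p.1 p.2.2 -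
    projKernel μ p.2.1 p.2.2

theorem measurable_projKernel_comp (μ : Measure ℝ) {α : Type*} [MeasurableSpace α] {f g : α → ℝ}
    (hf : Measurable f) (hg : Measurable g) : Measurable fun x => projKernel μ (f x) (g x) :=
  (measurable_projKernel μ).comp (hf.prodMk hg)

theorem measurable_degenerateKernel (μ : Measure ℝ) : Measurable (degenerateKernel μ) := by
  unfold degenerateKernel
  simp only [kernelPhi_eq]
  have h1 := measurable_kernelTerm_comp (α := ℝ × ℝ × ℝ) (f := fun p => p.1)
    (g := fun p => p.2.1) (h := fun p => p.2.2) (by fun_prop) (by fun_prop) (by fun_prop)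
  have h2 := measurable_kernelTerm_comp (α := ℝ × ℝ × ℝ) (f := fun p => p.1)
    (g := fun p => p.2.2) (h := fun p => p.2.1) (by fun_prop) (by fun_prop) (by fun_prop)
  have h3 := measurable_kernelTerm_comp (α := ℝ × ℝ × ℝ) (f := fun p => p.2.1)
    (g := fun p => p.2.2) (h := fun p => p.1) (by fun_prop) (by fun_prop) (by fun_prop)
  have k1 := measurable_projKernel_comp μ (α := ℝ × ℝ × ℝ) (f := fun p => p.1)
    (g := fun p => p.2.1) (by fun_prop) (by fun_prop)
  have k2 := measurable_projKernel_comp μ (α := ℝ × ℝ × ℝ) (f := fun p => p.1)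
    (g := fun p => p.2.2) (by fun_prop) (by fun_prop)
  have k3 := measurable_projKernel_comp μ (α := ℝ × ℝ × ℝ) (f := fun p => p.2.1)
    (g := fun p => p.2.2) (by fun_prop) (by fun_prop)
  exact ((((h1.add h2).add h3).div_const 3).sub k1 |>.sub k2).sub k3

theorem abs_degenerateKernel_le (μ : Measure ℝ) (p : ℝ × ℝ × ℝ) : |degenerateKernel μ p| ≤ 4 := by
  obtain ⟨x, y, z⟩ := p
  have h1 := abs_le.1 (abs_kernelTerm_le x y z)
  have h2 := abs_le.1 (abs_kernelTerm_le x z y)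
  have h3 := abs_le.1 (abs_kernelTerm_le y z x)
  have k1 := abs_le.1 (abs_projKernel_le μ x y)
  have k2 := abs_le.1 (abs_projKernel_le μ x z)
  have k3 := abs_le.1 (abs_projKernel_le μ y z)
  simp only [degenerateKernel, kernelPhi_eq]
  rw [abs_le]
  constructor <;> linarith [h1.1, h1.2, h2.1, h2.2, h3.1, h3.2, k1.1, k1.2, k2.1, k2.2, k3.1, k3.2]

/-- Oddness removes every term in which `x` enters oddly; the surviving third of `3 φ_F(y, z)`
cancels the subtracted `φ_F(y, z)`. -/
theorem integral_degenerateKernel_first (hcont : Continuous (cdf μ))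
    (hH₀ : ∀ x : ℝ, 1 - cdf μ x - cdf μ (-x) = 0) (y z : ℝ) :
    ∫ x, degenerateKernel μ (x, y, z) ∂μ = 0 := by
  have hneg := map_neg_eq_self hcont hH₀
  have hp : ∀ y, Integrable (fun x => projKernel μ x y) μ := fun y =>
    Integrable.of_bound (measurable_projKernel_comp μ measurable_id
      measurable_const).aestronglyMeasurable 1 (Eventually.of_forall fun _ => abs_projKernel_le _ _ _)
  have t1 : Integrable (fun x => kernelTerm x y z) μ :=
    integrable_kernelTerm_comp measurable_id measurable_const measurable_const
  have t2 : Integrable (fun x => kernelTerm x z y) μ :=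
    integrable_kernelTerm_comp measurable_id measurable_const measurable_const
  have t3 : Integrable (fun x => kernelTerm y z x) μ :=
    integrable_kernelTerm_comp measurable_const measurable_const measurable_id
  simp only [degenerateKernel, kernelPhi_eq]
  rw [integral_sub, integral_sub, integral_sub, integral_div, integral_add, integral_add t1 t2,
    integral_kernelTerm hcont hH₀, integral_projKernel_left hneg, integral_projKernel_left hneg,
    integral_eq_zero_of_odd hneg fun x => kernelTerm_neg x y z,
    integral_eq_zero_of_odd hneg fun x => kernelTerm_neg x z y]
  · simp
  · exact t1.add t2
  · exact t3
  · exact ((t1.add t2).add t3).div_const 3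
  · exact hp y
  · exact (((t1.add t2).add t3).div_const 3).sub (hp y)
  · exact hp z
  · exact ((((t1.add t2).add t3).div_const 3).sub (hp y)).sub (hp z)
  · exact integrable_const _

/-- With `degenerateKernel_rotate`, this brings any argument to the first place, so that all three
marginal integrals vanish. -/
theorem degenerateKernel_swap (μ : Measure ℝ) (x y z : ℝ) :
    degenerateKernel μ (x, y, z) = degenerateKernel μ (y, x, z) := by
  simp only [degenerateKernel, kernelPhi_eq]
  rw [kernelTerm_comm x y z, projKernel_comm μ x y]
  ring

theorem degenerateKernel_rotate (μ : Measure ℝ) (x y z : ℝ) :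
    degenerateKernel μ (x, y, z) = degenerateKernel μ (z, x, y) := by
  simp only [degenerateKernel, kernelPhi_eq]
  rw [kernelTerm_comm z x y, kernelTerm_comm z y x, projKernel_comm μ x z, projKernel_comm μ y z]
  ring

end Symmetry

/-! ### The Hoeffding decomposition of `n J_n` -/

section Hoeffding

theorem sum_range_sum_range_add (g : ℕ → ℝ) (n : ℕ) :
    ∑ j ∈ Finset.range n, ∑ i ∈ Finset.range j, (g i + g j) =
      ((n : ℝ) - 1) * ∑ j ∈ Finset.range n, g j := by
  induction n with
  | zero => simp
  | succ n ih =>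
    rw [Finset.sum_range_succ, ih, Finset.sum_add_distrib, Finset.sum_const, Finset.card_range,
      Finset.sum_range_succ g n, nsmul_eq_mul]
    push_cast
    ring

/-- Each pair lies in `n - 2` triples. The factor of the quadratic part is therefore `n (n - 2) /
C(n, 3) = 6 / (n - 1)`. -/
theorem sum_triples_eq_sum_pairs (g : ℕ → ℕ → ℝ) (n : ℕ) :
    ∑ k ∈ Finset.range n, ∑ j ∈ Finset.range k, ∑ i ∈ Finset.range j, (g i j + g i k + g j k) =
      ((n : ℝ) - 2) * ∑ k ∈ Finset.range n, ∑ j ∈ Finset.range k, g j k := by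
  induction n with
  | zero => simp
  | succ n ih =>
    rw [Finset.sum_range_succ, ih, Finset.sum_range_succ _ n]
    have h : ∑ j ∈ Finset.range n, ∑ i ∈ Finset.range j, (g i j + g i n + g j n) =
        ∑ j ∈ Finset.range n, ∑ i ∈ Finset.range j, g i j +
          ∑ j ∈ Finset.range n, ∑ i ∈ Finset.range j, (g i n + g j n) := by
      simp only [← Finset.sum_add_distrib, add_assoc]
    rw [h, sum_range_sum_range_add (fun j => g j n)]
    push_cast
    ring

theorem cast_choose_three (n : ℕ) :
    ((n.choose 3 : ℕ) : ℝ) = n * (n - 1) * (n - 2) / 6 := by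
  induction n with
  | zero => simp
  | succ n ih =>
    rw [Nat.choose_succ_succ, Nat.cast_add, ih, Nat.cast_choose_two]
    push_cast
    ring

/-- The quadratic part of `n J_n`. -/
def quadraticPart (q : ℝ → ℝ → ℝ) (n : ℕ) (x : ℕ → ℝ) : ℝ :=
  6 / ((n : ℝ) - 1) * ∑ k ∈ Finset.range n, ∑ j ∈ Finset.range k, q (x j) (x k)

/-- The Hoeffding decomposition of `n J_n`. -/
theorem mul_statJ_eq (μ : Measure ℝ) {n : ℕ} (hn : 3 ≤ n) (x : ℕ → ℝ) :
    (n : ℝ) * statJ n x = quadraticPart (projKernel μ) n x +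
      n / (n.choose 3 : ℕ) * ∑ k ∈ Finset.range n, ∑ j ∈ Finset.range k, ∑ i ∈ Finset.range j,
        degenerateKernel μ (x i, x j, x k) := by
  have hn' : (3 : ℝ) ≤ n := by exact_mod_cast hn
  have h := sum_triples_eq_sum_pairs (fun i j => projKernel μ (x i) (x j)) n
  have hs : ∑ k ∈ Finset.range n, ∑ j ∈ Finset.range k, ∑ i ∈ Finset.range j,
      kernelPhi ![x i, x j, x k] =
      ∑ k ∈ Finset.range n, ∑ j ∈ Finset.range k, ∑ i ∈ Finset.range j,
        degenerateKernel μ (x i, x j, x k) +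
      ∑ k ∈ Finset.range n, ∑ j ∈ Finset.range k, ∑ i ∈ Finset.range j,
        (projKernel μ (x i) (x j) + projKernel μ (x i) (x k) + projKernel μ (x j) (x k)) := by
    simp only [← Finset.sum_add_distrib, degenerateKernel]
    refine Finset.sum_congr rfl fun k _ => Finset.sum_congr rfl fun j _ =>
      Finset.sum_congr rfl fun i _ => ?_
    ring
  have h0 : (n : ℝ) ≠ 0 := by positivity
  have h1 : (n : ℝ) - 1 ≠ 0 := by linarith
  have h2 : (n : ℝ) - 2 ≠ 0 := by linarith
  rw [statJ, hs, h, quadraticPart, cast_choose_three]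
  field_simp
  ring

variable {Ω : Type*} [MeasurableSpace Ω] {P : Measure Ω} [IsProbabilityMeasure P]
  {X : ℕ → Ω → ℝ} {μ : Measure ℝ} [IsProbabilityMeasure μ]

theorem integral_sq_mul_statJ_sub_le (hX : ∀ i, Measurable (X i)) (hind : iIndepFun X P)
    (hlaw : ∀ i, P.map (X i) = μ) (hcont : Continuous (cdf μ))
    (hH₀ : ∀ x : ℝ, 1 - cdf μ x - cdf μ (-x) = 0) {n : ℕ} (hn : 4 ≤ n) :
    MemLp (fun ω => (n : ℝ) * statJ n (fun i => X i ω) -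
      quadraticPart (projKernel μ) n fun i => X i ω) 2 P ∧
    ∫ ω, ((n : ℝ) * statJ n (fun i => X i ω) -
      quadraticPart (projKernel μ) n fun i => X i ω) ^ 2 ∂P ≤ 9216 / n := by
  have hfirst := integral_degenerateKernel_first hcont hH₀
  have h := integral_sq_sum_triples_le hX hind hlaw (degenerateKernel μ)
    (measurable_degenerateKernel μ) (abs_degenerateKernel_le μ) hfirst
    (fun x z => by simp only [degenerateKernel_swap μ x, hfirst])
    (fun x y => by simp only [degenerateKernel_rotate μ x y, hfirst]) n
  simp only [fun ω => mul_statJ_eq μ (show 3 ≤ n by omega) (fun i => X i ω), add_sub_cancel_left]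
  refine ⟨h.1.const_mul _, ?_⟩
  simp only [mul_pow]
  rw [integral_const_mul]
  refine (mul_le_mul_of_nonneg_left h.2 (sq_nonneg _)).trans ?_
  have hn' : (4 : ℝ) ≤ n := by exact_mod_cast hn
  have h0 : (0 : ℝ) < n := by positivity
  have h1 : (n : ℝ) / 2 ≤ n - 1 := by linarith
  have h2 : (n : ℝ) / 2 ≤ n - 2 := by linarith
  -- For `n ≥ 4` both `n - 1` and `n - 2` are at least `n / 2`. The final constant is `9216 = 24 ^ 2
  -- * 4 ^ 2`, with `4` the bound on the degenerate kernel.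
  have hc : (n : ℝ) ^ 3 / 24 ≤ (n.choose 3 : ℕ) := by
    rw [cast_choose_three]
    have : (n : ℝ) / 2 * (n / 2) ≤ (n - 1) * (n - 2) :=
      mul_le_mul h1 h2 (by positivity) (by linarith)
    nlinarith
  have hd : (n : ℝ) / (n.choose 3 : ℕ) ≤ 24 / n ^ 2 := by
    rw [div_le_div_iff₀ (lt_of_lt_of_le (by positivity) hc) (by positivity)]
    nlinarith
  calc ((n : ℝ) / (n.choose 3 : ℕ)) ^ 2 * ((n : ℝ) ^ 3 * (4 : ℝ) ^ 2)
      ≤ (24 / n ^ 2) ^ 2 * ((n : ℝ) ^ 3 * (4 : ℝ) ^ 2) := by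
        refine mul_le_mul_of_nonneg_right (pow_le_pow_left₀ (by positivity) hd 2) (by positivity)
    _ = (9216 : ℝ) / n := by field_simp; norm_num

theorem integral_sq_quadraticPart_le (hX : ∀ i, Measurable (X i)) (hind : iIndepFun X P)
    (hlaw : ∀ i, P.map (X i) = μ) (q : ℝ × ℝ → ℝ) (hq : Measurable q)
    (hq2 : MemLp q 2 (μ.prod μ)) (h1 : ∀ y, ∫ x, q (x, y) ∂μ = 0)
    (h2 : ∀ x, ∫ y, q (x, y) ∂μ = 0) {n : ℕ} (hn : 2 ≤ n) :
    MemLp (fun ω => quadraticPart (fun x y => q (x, y)) n fun i => X i ω) 2 P ∧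
    ∫ ω, (quadraticPart (fun x y => q (x, y)) n fun i => X i ω) ^ 2 ∂P ≤
      144 * ∫ p, q p ^ 2 ∂(μ.prod μ) := by
  have h := integral_sq_sum_pairs_le hX hind hlaw q hq hq2 h1 h2 n
  unfold quadraticPart
  refine ⟨h.1.const_mul _, ?_⟩
  simp only [mul_pow]
  rw [integral_const_mul]
  refine (mul_le_mul_of_nonneg_left h.2 (sq_nonneg _)).trans ?_
  rw [← mul_assoc]
  refine mul_le_mul_of_nonneg_right ?_ (integral_nonneg fun _ => sq_nonneg _)
  have hn' : (2 : ℝ) ≤ n := by exact_mod_cast hn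
  -- The factor `6 n / (n - 1)` is at most `12` once `n ≥ 2`.
  rw [← mul_pow, show (144 : ℝ) = 12 ^ 2 by norm_num]
  have h1 : (0 : ℝ) < n - 1 := by linarith
  refine pow_le_pow_left₀ (by positivity) ?_ 2
  rw [div_mul_eq_mul_div, div_le_iff₀ h1]
  linarith

end Hoeffding

/-! ### Approximation by kernels of finite rank -/

section FiniteRank

variable {μ : Measure ℝ} {κ : Type*} {ν : κ → ℝ} {e : κ → Lp ℝ 2 μ}

theorem measurable_coe_Lp (v : Lp ℝ 2 μ) : Measurable v := (Lp.stronglyMeasurable v).measurable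

/-- The kernel of finite rank spanned by the eigenvectors indexed by `s`. -/
def finiteRankKernel (s : Finset κ) (ν : κ → ℝ) (e : κ → Lp ℝ 2 μ) (x y : ℝ) : ℝ :=
  ∑ i ∈ s, ν i * (e i x * e i y)

theorem integral_mul_eq_inner (u v : Lp ℝ 2 μ) : ∫ x, u x * v x ∂μ = inner ℝ u v := by
  rw [L2.inner_def]
  simp [mul_comm]

theorem integrable_mul_coe_Lp (u v : Lp ℝ 2 μ) : Integrable (fun x => u x * v x) μ :=
  (Lp.memLp u).integrable_mul (Lp.memLp v)

theorem finiteRankKernel_comm (s : Finset κ) (x y : ℝ) :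
    finiteRankKernel s ν e x y = finiteRankKernel s ν e y x :=
  Finset.sum_congr rfl fun i _ => by ring

theorem measurable_finiteRankKernel (s : Finset κ) :
    Measurable fun p : ℝ × ℝ => finiteRankKernel s ν e p.1 p.2 := by
  unfold finiteRankKernel
  refine Finset.measurable_sum _ fun i _ => Measurable.const_mul ?_ _
  exact ((measurable_coe_Lp _).comp measurable_fst).mul ((measurable_coe_Lp _).comp measurable_snd)

theorem memLp_mul_prod_coe_Lp [SFinite μ] (u v : Lp ℝ 2 μ) :
    MemLp (fun p : ℝ × ℝ => u p.1 * v p.2) 2 (μ.prod μ) := by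
  rw [memLp_two_iff_integrable_sq]
  · simp only [mul_pow]
    exact (Lp.memLp u).integrable_sq.mul_prod (Lp.memLp v).integrable_sq
  · exact (((measurable_coe_Lp u).comp measurable_fst).mul
      ((measurable_coe_Lp v).comp measurable_snd)).aestronglyMeasurable

variable [IsProbabilityMeasure μ]

theorem integrable_coe_Lp (v : Lp ℝ 2 μ) : Integrable v μ :=
  (Lp.memLp v).integrable (by norm_num)

/-- Integrating the eigenvalue equation and exchanging integrals gives `r ∫ v = 0`, since `φ_F(·,
y)` has mean zero. -/
theorem integral_eq_zero_of_opJ_eq (hneg : μ.map (fun x => -x) = μ) {r : ℝ} (hr : r ≠ 0)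
    {v : Lp ℝ 2 μ} (hv : opJ μ v = r • v) : ∫ x, v x ∂μ = 0 := by
  have hint : Integrable (fun p : ℝ × ℝ => projKernel μ p.1 p.2 * v p.2) (μ.prod μ) := by
    refine Integrable.bdd_mul (c := 1) ?_ (measurable_projKernel μ).aestronglyMeasurable
      (Eventually.of_forall fun p => abs_projKernel_le μ p.1 p.2)
    exact (integrable_coe_Lp v).comp_snd μ
  have h1 : ∫ x, opJ μ v x ∂μ = 0 := by
    have : ∫ x, opJ μ v x ∂μ = ∫ x, ∫ y, projKernel μ x y * v y ∂μ ∂μ := by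
      refine integral_congr_ae ?_
      filter_upwards [coeFn_opJ μ v] with x hx
      rw [hx, inner_kernelSection]
    rw [this, integral_integral_swap hint]
    simp only [integral_mul_const, integral_projKernel_left hneg, zero_mul, integral_zero]
  rw [hv] at h1
  have h2 : ∫ x, (r • v : Lp ℝ 2 μ) x ∂μ = r * ∫ x, v x ∂μ := by
    rw [← integral_const_mul]
    refine integral_congr_ae ?_
    filter_upwards [Lp.coeFn_smul r v] with x hx
    rw [hx, Pi.smul_apply, smul_eq_mul]
  rw [h2] at h1
  exact (mul_eq_zero.1 h1).resolve_left hr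

theorem memLp_finiteRankKernel (s : Finset κ) :
    MemLp (fun p : ℝ × ℝ => finiteRankKernel s ν e p.1 p.2) 2 (μ.prod μ) :=
  memLp_finsetSum _ fun i _ => (memLp_mul_prod_coe_Lp (e i) (e i)).const_mul _

theorem memLp_projKernel_prod :
    MemLp (fun p : ℝ × ℝ => projKernel μ p.1 p.2) 2 (μ.prod μ) :=
  MemLp.of_bound (measurable_projKernel μ).aestronglyMeasurable 1
    (Eventually.of_forall fun p => abs_projKernel_le μ p.1 p.2)

theorem integral_projKernel_mul_prod (u v : Lp ℝ 2 μ) :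
    ∫ p : ℝ × ℝ, projKernel μ p.1 p.2 * (u p.1 * v p.2) ∂(μ.prod μ) = inner ℝ u (opJ μ v) := by
  have hint : Integrable (fun p : ℝ × ℝ => projKernel μ p.1 p.2 * (u p.1 * v p.2)) (μ.prod μ) :=
    ((integrable_coe_Lp u).mul_prod (integrable_coe_Lp v)).bdd_mul (c := 1)
      (measurable_projKernel μ).aestronglyMeasurable
      (Eventually.of_forall fun p => abs_projKernel_le μ p.1 p.2)
  rw [integral_prod _ hint, ← integral_mul_eq_inner]
  refine integral_congr_ae ?_
  filter_upwards [coeFn_opJ μ v] with x hx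
  rw [hx, inner_kernelSection, ← integral_const_mul]
  congr 1 with y
  ring

/-- Pythagoras: the functions `e i x * e i y` are orthonormal in `L²(μ ⊗ μ)` and `φ_F` has
coefficient `ν i` along each, so the finite rank kernel is an orthogonal projection of `φ_F`. -/
theorem integral_sq_sub_finiteRankKernel (he : Orthonormal ℝ e)
    (hJ : ∀ i, opJ μ (e i) = ν i • e i) (s : Finset κ) :
    ∫ p : ℝ × ℝ, (projKernel μ p.1 p.2 - finiteRankKernel s ν e p.1 p.2) ^ 2 ∂(μ.prod μ) =
      ∫ x, ∫ y, projKernel μ x y ^ 2 ∂μ ∂μ - ∑ i ∈ s, ν i ^ 2 := by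
  classical
  have hφ := memLp_projKernel_prod (μ := μ)
  have hK := memLp_finiteRankKernel (ν := ν) (e := e) s
  have hterm := fun i => memLp_mul_prod_coe_Lp (e i) (e i)
  have hcross : ∫ p : ℝ × ℝ, projKernel μ p.1 p.2 * finiteRankKernel s ν e p.1 p.2 ∂(μ.prod μ) =
      ∑ i ∈ s, ν i ^ 2 := by
    simp only [finiteRankKernel, Finset.mul_sum]
    rw [integral_finsetSum]
    · refine Finset.sum_congr rfl fun i _ => ?_
      simp only [mul_left_comm _ (ν i)]
      rw [integral_const_mul, integral_projKernel_mul_prod, hJ, inner_smul_right,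
        real_inner_self_eq_norm_sq, he.1 i]
      ring
    · intro i _
      exact hφ.integrable_mul ((hterm i).const_mul (ν i))
  have hdiag : ∫ p : ℝ × ℝ, finiteRankKernel s ν e p.1 p.2 ^ 2 ∂(μ.prod μ) =
      ∑ i ∈ s, ν i ^ 2 := by
    have hsq : ∀ p : ℝ × ℝ, finiteRankKernel s ν e p.1 p.2 ^ 2 =
        ∑ i ∈ s, ∑ j ∈ s, ν i * ν j * ((e i p.1 * e j p.1) * (e i p.2 * e j p.2)) := by
      intro p
      rw [finiteRankKernel, pow_two, Finset.sum_mul_sum]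
      refine Finset.sum_congr rfl fun i _ => Finset.sum_congr rfl fun j _ => ?_
      ring
    have hint : ∀ i j, Integrable (fun p : ℝ × ℝ =>
        ν i * ν j * ((e i p.1 * e j p.1) * (e i p.2 * e j p.2))) (μ.prod μ) := fun i j =>
      ((integrable_mul_coe_Lp (e i) (e j)).mul_prod
        (integrable_mul_coe_Lp (e i) (e j))).const_mul _
    simp only [hsq]
    rw [integral_finsetSum _ fun i _ => integrable_finsetSum _ fun j _ => hint i j]
    refine Finset.sum_congr rfl fun i hi => ?_
    rw [integral_finsetSum _ fun j _ => hint i j, Finset.sum_eq_single_of_mem i hi]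
    · rw [integral_const_mul,
        integral_prod_mul (fun x => e i x * e i x) (fun x => e i x * e i x),
        integral_mul_eq_inner, real_inner_self_eq_norm_sq, he.1 i]
      ring
    · intro j _ hji
      rw [integral_const_mul,
        integral_prod_mul (fun x => e i x * e j x) (fun x => e i x * e j x),
        integral_mul_eq_inner, he.2 hji.symm]
      ring
  have hsqφ : ∫ p : ℝ × ℝ, projKernel μ p.1 p.2 ^ 2 ∂(μ.prod μ) =
      ∫ x, ∫ y, projKernel μ x y ^ 2 ∂μ ∂μ := integral_prod _ hφ.integrable_sq
  have hexp : ∀ p : ℝ × ℝ, (projKernel μ p.1 p.2 - finiteRankKernel s ν e p.1 p.2) ^ 2 =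
      projKernel μ p.1 p.2 ^ 2 - 2 * (projKernel μ p.1 p.2 * finiteRankKernel s ν e p.1 p.2) +
        finiteRankKernel s ν e p.1 p.2 ^ 2 := fun p => by ring
  simp only [hexp]
  rw [integral_add, integral_sub, integral_const_mul, hcross, hdiag, hsqφ]
  · ring
  · exact hφ.integrable_sq
  · exact (hφ.integrable_mul hK).const_mul 2
  · exact hφ.integrable_sq.sub ((hφ.integrable_mul hK).const_mul 2)
  · exact hK.integrable_sq

/-- Truncation keeps the kernel degenerate, so the second moment bound for pairs applies to the
error. -/
theorem integral_projKernel_sub_finiteRankKernel (hneg : μ.map (fun x => -x) = μ)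
    (hν : ∀ i, ν i ≠ 0) (hJ : ∀ i, opJ μ (e i) = ν i • e i) (s : Finset κ) (y : ℝ) :
    ∫ x, (projKernel μ x y - finiteRankKernel s ν e x y) ∂μ = 0 := by
  have hint : ∀ i ∈ s, Integrable (fun x => ν i * (e i x * e i y)) μ := fun i _ =>
    ((integrable_coe_Lp (e i)).mul_const _).const_mul _
  rw [integral_sub, integral_projKernel_left hneg]
  · simp only [finiteRankKernel]
    rw [integral_finsetSum _ hint, Finset.sum_eq_zero, sub_zero]
    intro i _
    rw [integral_const_mul, integral_mul_const, integral_eq_zero_of_opJ_eq hneg (hν i) (hJ i)]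
    ring
  · exact Integrable.of_bound (measurable_projKernel_comp μ measurable_id
      measurable_const).aestronglyMeasurable 1 (Eventually.of_forall fun _ => abs_projKernel_le _ _ _)
  · exact integrable_finsetSum _ hint

end FiniteRank

/-! ### Characteristic functions and convergence in distribution -/

section CharFun

variable {Ω : Type*} [MeasurableSpace Ω] {P : Measure Ω} [IsProbabilityMeasure P]
  {Ω' : Type*} [MeasurableSpace Ω'] {P' : Measure Ω'} [IsProbabilityMeasure P']
  {E : Type*} [NormedAddCommGroup E] [InnerProductSpace ℝ E] [MeasurableSpace E] [BorelSpace E]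
  [FiniteDimensional ℝ E]

theorem tendstoInDistribution_of_charFun {Y : ℕ → Ω → E} {Z : Ω' → E}
    (hY : ∀ n, AEMeasurable (Y n) P) (hZ : AEMeasurable Z P')
    (h : ∀ t, Tendsto (fun n => charFun (P.map (Y n)) t) atTop (𝓝 (charFun (P'.map Z) t))) :
    TendstoInDistribution Y atTop Z (fun _ => P) P' where
  forall_aemeasurable := hY
  aemeasurable_limit := hZ
  tendsto := ProbabilityMeasure.tendsto_iff_tendsto_charFun.2 h

theorem MeasureTheory.TendstoInDistribution.tendsto_charFun {Y : ℕ → Ω → E} {Z : Ω' → E}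
    (h : TendstoInDistribution Y atTop Z (fun _ => P) P') (t : E) :
    Tendsto (fun n => charFun (P.map (Y n)) t) atTop (𝓝 (charFun (P'.map Z) t)) :=
  ProbabilityMeasure.tendsto_iff_tendsto_charFun.1 h.tendsto t

end CharFun

section CharFunMap

variable {Ω : Type*} [MeasurableSpace Ω] {P : Measure Ω}
  {E : Type*} [NormedAddCommGroup E] [InnerProductSpace ℝ E] [MeasurableSpace E] [BorelSpace E]
  [FiniteDimensional ℝ E]

theorem charFun_map_eq_integral {Y : Ω → E} (hY : AEMeasurable Y P) (t : E) :
    charFun (P.map Y) t = ∫ ω, Complex.exp ((inner ℝ (Y ω) t : ℝ) * Complex.I) ∂P := by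
  rw [charFun_apply, integral_map hY]
  fun_prop

/-- The characteristic function of a vector in terms of its one-dimensional projections. -/
theorem charFun_map_eq_charFun_inner {Y : Ω → E} (hY : AEMeasurable Y P) (t : E) :
    charFun (P.map Y) t = charFun (P.map fun ω => inner ℝ (Y ω) t) 1 := by
  rw [charFun_map_eq_integral hY, charFun_map_eq_integral (by fun_prop)]
  simp

end CharFunMap

theorem identDistrib_comp {Ω : Type*} [MeasurableSpace Ω] {P : Measure Ω} {X : ℕ → Ω → ℝ}
    {μ : Measure ℝ} (hX : ∀ i, Measurable (X i)) (hlaw : ∀ i, P.map (X i) = μ) {g : ℝ → ℝ}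
    (hg : Measurable g) (i : ℕ) :
    IdentDistrib (fun ω => g (X i ω)) (fun ω => g (X 0 ω)) P P := by
  have h : IdentDistrib (X i) (X 0) P P :=
    ⟨(hX i).aemeasurable, (hX 0).aemeasurable, by rw [hlaw, hlaw]⟩
  exact h.comp hg

theorem ae_tendsto_average {Ω : Type*} [MeasurableSpace Ω] {P : Measure Ω} {X : ℕ → Ω → ℝ}
    {μ : Measure ℝ} (hX : ∀ i, Measurable (X i)) (hind : iIndepFun X P)
    (hlaw : ∀ i, P.map (X i) = μ) {g : ℝ → ℝ} (hg : Measurable g) (hint : Integrable g μ) :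
    ∀ᵐ ω ∂P, Tendsto (fun n : ℕ => (∑ m ∈ Finset.range n, g (X m ω)) / n) atTop
      (𝓝 (∫ x, g x ∂μ)) := by
  have hint0 : Integrable (fun ω => g (X 0 ω)) P := by
    refine (integrable_map_measure (f := X 0) hg.aestronglyMeasurable (hX 0).aemeasurable).1 ?_
    rwa [hlaw 0]
  have h := strong_law_ae_real (fun m ω => g (X m ω)) hint0
    (fun i j hij => (hind.indepFun hij).comp hg hg) (identDistrib_comp hX hlaw hg)
  rwa [← integral_map (φ := X 0) (hX 0).aemeasurable hg.aestronglyMeasurable, hlaw 0] at h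

/-! ### Multivariate central limit theorem -/

section CentralLimit

variable {Ω : Type*} [MeasurableSpace Ω] {P : Measure Ω} [IsProbabilityMeasure P]
  {Ω' : Type*} [MeasurableSpace Ω'] {P' : Measure Ω'} [IsProbabilityMeasure P']
  {ι : Type*} [Fintype ι]

theorem hasLaw_sum_mul_gaussianReal {W : ι → Ω' → ℝ} (hind : iIndepFun W P')
    (hlaw : ∀ i, HasLaw (W i) (gaussianReal 0 1) P') (t : ι → ℝ) :
    HasLaw (fun ω => ∑ i, t i * W i ω) (gaussianReal 0 (∑ i, t i ^ 2).toNNReal) P' := by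
  have hm : ∀ i, AEMeasurable (fun ω => t i * W i ω) P' := fun i =>
    (hlaw i).aemeasurable.const_mul _
  have hmS : AEMeasurable (fun ω => ∑ i, t i * W i ω) P' := by
    fun_prop
  refine ⟨hmS, ?_⟩
  have : IsProbabilityMeasure (P'.map fun ω => ∑ i, t i * W i ω) :=
    Measure.isProbabilityMeasure_map hmS
  refine Measure.ext_of_charFun ?_
  ext s
  have hind' : iIndepFun (fun i ω => t i * W i ω) P' :=
    hind.comp (fun i x => t i * x) fun i => measurable_const_mul (t i)
  rw [hind'.charFun_map_fun_sum_eq_prod hm, Finset.prod_apply]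
  have h : ∀ i, charFun (P'.map fun ω => t i * W i ω) s =
      Complex.exp (-((t i ^ 2 * s ^ 2 : ℝ) : ℂ) / 2) := by
    intro i
    rw [charFun_map_mul_comp (hlaw i).aemeasurable, (hlaw i).map_eq, charFun_gaussianReal]
    congr 1
    push_cast
    ring
  simp only [h]
  rw [← Complex.exp_sum, charFun_gaussianReal]
  congr 1
  have hnn : (((∑ i, t i ^ 2).toNNReal : NNReal) : ℂ) = ((∑ i, t i ^ 2 : ℝ) : ℂ) := by
    rw [← Real.coe_toNNReal (∑ i, t i ^ 2) (Finset.sum_nonneg fun _ _ => sq_nonneg _)]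
    simp
  rw [hnn]
  push_cast
  rw [← Finset.sum_div, Finset.sum_neg_distrib, ← Finset.sum_mul]
  ring

variable {X : ℕ → Ω → ℝ} {μ : Measure ℝ} [IsProbabilityMeasure μ]

/-- The multivariate central limit theorem for orthonormal functions of an i.i.d. sample. -/
theorem tendstoInDistribution_orthonormal (hX : ∀ i, Measurable (X i)) (hind : iIndepFun X P)
    (hlaw : ∀ i, P.map (X i) = μ) {W : ι → Ω' → ℝ} (hWind : iIndepFun W P')
    (hWlaw : ∀ i, HasLaw (W i) (gaussianReal 0 1) P') {g : ι → ℝ → ℝ}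
    (hg : ∀ i, Measurable (g i)) (hg2 : ∀ i, MemLp (g i) 2 μ) (h0 : ∀ i, ∫ x, g i x ∂μ = 0)
    (h1 : ∀ i, ∫ x, g i x * g i x ∂μ = 1) (h2 : ∀ i j, i ≠ j → ∫ x, g i x * g j x ∂μ = 0) :
    TendstoInDistribution
      (fun (n : ℕ) ω => (WithLp.toLp 2 fun i => (√n)⁻¹ * ∑ m ∈ Finset.range n, g i (X m ω) :
        EuclideanSpace ℝ ι)) atTop
      (fun ω => (WithLp.toLp 2 fun i => W i ω : EuclideanSpace ℝ ι)) (fun _ => P) P' := by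
  classical
  have hWm : ∀ i, AEMeasurable (W i) P' := fun i => (hWlaw i).aemeasurable
  have hYm : ∀ n : ℕ, AEMeasurable (fun ω =>
      (WithLp.toLp 2 fun i => (√n)⁻¹ * ∑ m ∈ Finset.range n, g i (X m ω) :
        EuclideanSpace ℝ ι)) P := by
    intro n
    have : Measurable (fun ω => fun i => (√n)⁻¹ * ∑ m ∈ Finset.range n, g i (X m ω)) := by
      fun_prop
    exact ((PiLp.continuous_toLp 2 _).measurable.comp this).aemeasurable
  have hZm : AEMeasurable (fun ω => (WithLp.toLp 2 fun i => W i ω : EuclideanSpace ℝ ι)) P' :=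
    (PiLp.continuous_toLp 2 _).measurable.comp_aemeasurable (aemeasurable_pi_lambda _ hWm)
  refine tendstoInDistribution_of_charFun hYm hZm fun t => ?_
  -- Cramér-Wold: at frequency `t` only the combination `∑ t i * g i` matters. It is centred with
  -- variance `∑ t i ^ 2`, so the scalar theorem applies.
  have hG : Measurable fun x => ∑ i, t i * g i x := by fun_prop
  have hG2 : MemLp (fun x => ∑ i, t i * g i x) 2 μ :=
    memLp_finsetSum _ fun i _ => (hg2 i).const_mul _
  have hmean : ∫ x, ∑ i, t i * g i x ∂μ = 0 := by
    rw [integral_finsetSum _ fun i _ => ((hg2 i).integrable (by norm_num)).const_mul _]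
    simp [integral_const_mul, h0]
  have hsq : ∫ x, (∑ i, t i * g i x) ^ 2 ∂μ = ∑ i, t i ^ 2 := by
    rw [integral_sq_sum_of_orthogonal Finset.univ (fun i x => t i * g i x)
      fun i _ => (hg2 i).const_mul _]
    · refine Finset.sum_congr rfl fun i _ => ?_
      have : ∀ x, (t i * g i x) ^ 2 = t i ^ 2 * (g i x * g i x) := fun x => by ring
      simp only [this]
      rw [integral_const_mul, h1, mul_one]
    · intro i _ j _ hij
      have : ∀ x, t i * g i x * (t j * g j x) = t i * t j * (g i x * g j x) := fun x => by ring
      simp only [this]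
      rw [integral_const_mul, h2 i j hij, mul_zero]
  have hmP : ∫ ω, ∑ i, t i * g i (X 0 ω) ∂P = 0 := by
    rw [← hmean, ← hlaw 0, integral_map (hX 0).aemeasurable hG.aestronglyMeasurable]
  have hsP : ∫ ω, (∑ i, t i * g i (X 0 ω)) ^ 2 ∂P = ∑ i, t i ^ 2 := by
    rw [← hsq, ← hlaw 0, integral_map (hX 0).aemeasurable
      (hG.pow_const 2).aestronglyMeasurable]
  have hvar : Var[fun ω => ∑ i, t i * g i (X 0 ω); P] = ∑ i, t i ^ 2 := by
    exact (variance_of_integral_eq_zero (hG.comp (hX 0)).aemeasurable hmP).trans hsP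
  have hL2 : MemLp (fun ω => ∑ i, t i * g i (X 0 ω)) 2 P := by
    refine (memLp_map_measure_iff (f := X 0) hG.aestronglyMeasurable (hX 0).aemeasurable).1 ?_
    rw [hlaw 0]
    exact hG2
  have hclt := tendstoInDistribution_inv_sqrt_mul_sum_sub (P := P) (P' := P')
    (X := fun m ω => ∑ i, t i * g i (X m ω)) (Y := fun ω => ∑ i, t i * W i ω)
    (by rw [hvar]; exact hasLaw_sum_mul_gaussianReal hWind hWlaw t) hL2
    (hind.comp (fun _ x => ∑ i, t i * g i x) fun _ => hG)
    (fun m => identDistrib_comp hX hlaw hG m)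
  have hlim := hclt.tendsto_charFun 1
  rw [hmP] at hlim
  rw [charFun_map_eq_charFun_inner hZm]
  simp only [fun n => charFun_map_eq_charFun_inner (hYm n) t]
  have hZ : (fun ω => inner ℝ (WithLp.toLp 2 fun i => W i ω : EuclideanSpace ℝ ι) t) =
      fun ω => ∑ i, t i * W i ω := by
    ext ω
    simp [PiLp.inner_apply]
  have hY : ∀ n : ℕ, (fun ω => inner ℝ (WithLp.toLp 2 fun i =>
      (√n)⁻¹ * ∑ m ∈ Finset.range n, g i (X m ω) : EuclideanSpace ℝ ι) t) =
      fun ω => (√n)⁻¹ * (∑ m ∈ Finset.range n, ∑ i, t i * g i (X m ω) - n * 0) := by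
    intro n
    ext ω
    simp only [PiLp.inner_apply, RCLike.inner_apply, conj_trivial, mul_zero, sub_zero]
    rw [Finset.sum_comm, Finset.mul_sum]
    refine Finset.sum_congr rfl fun i _ => ?_
    rw [← Finset.mul_sum]
    ring
  rw [hZ]
  simp only [hY]
  exact hlim

end CentralLimit

/-! ### Limit law for kernels of finite rank -/

section QuadraticForm

theorem two_mul_sum_pairs_mul (a : ℕ → ℝ) (n : ℕ) :
    2 * ∑ k ∈ Finset.range n, ∑ j ∈ Finset.range k, a j * a k =
      (∑ m ∈ Finset.range n, a m) ^ 2 - ∑ m ∈ Finset.range n, a m ^ 2 := by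
  induction n with
  | zero => simp
  | succ n ih =>
    rw [Finset.sum_range_succ, mul_add, ih, Finset.sum_range_succ a, ← Finset.sum_mul,
      Finset.sum_range_succ (fun m => a m ^ 2)]
    ring

variable {μ : Measure ℝ} {κ : Type*} {ν : κ → ℝ} {e : κ → Lp ℝ 2 μ}

/-- A sum over pairs is half the square of the sum minus the diagonal. The squares are handled by
the central limit theorem, the diagonal by the law of large numbers. -/
theorem quadraticPart_finiteRankKernel (s : Finset κ) {n : ℕ} (hn : 2 ≤ n) (x : ℕ → ℝ) :
    quadraticPart (finiteRankKernel s ν e) n x = 3 * (n / ((n : ℝ) - 1)) *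
      (∑ i : s, ν i * ((√n)⁻¹ * ∑ m ∈ Finset.range n, e i (x m)) ^ 2 -
        ∑ i : s, ν i * ((∑ m ∈ Finset.range n, e i (x m) ^ 2) / n)) := by
  have hn' : (2 : ℝ) ≤ n := by exact_mod_cast hn
  have h0 : (n : ℝ) ≠ 0 := by positivity
  have h1 : (n : ℝ) - 1 ≠ 0 := by linarith
  have h : ∑ k ∈ Finset.range n, ∑ j ∈ Finset.range k, finiteRankKernel s ν e (x j) (x k) =
      ∑ i ∈ s, ν i * ∑ k ∈ Finset.range n, ∑ j ∈ Finset.range k, e i (x j) * e i (x k) := by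
    simp only [finiteRankKernel, Finset.mul_sum]
    rw [Finset.sum_comm (s := s)]
    exact Finset.sum_congr rfl fun k _ => Finset.sum_comm
  rw [quadraticPart, h, Finset.sum_coe_sort s fun i => ν i * ((√n)⁻¹ * ∑ m ∈ Finset.range n, e i (x m)) ^ 2,
    Finset.sum_coe_sort s fun i => ν i * ((∑ m ∈ Finset.range n, e i (x m) ^ 2) / n),
    ← Finset.sum_sub_distrib, Finset.mul_sum, Finset.mul_sum]
  refine Finset.sum_congr rfl fun i _ => ?_
  have h2 := two_mul_sum_pairs_mul (fun m => e i (x m)) n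
  rw [mul_pow, inv_pow, Real.sq_sqrt (by positivity)]
  have h3 : ∑ k ∈ Finset.range n, ∑ j ∈ Finset.range k, e i (x j) * e i (x k) =
      ((∑ m ∈ Finset.range n, e i (x m)) ^ 2 - ∑ m ∈ Finset.range n, e i (x m) ^ 2) / 2 := by
    linarith
  rw [h3]
  field_simp
  ring

variable [IsProbabilityMeasure μ] {Ω : Type*} [MeasurableSpace Ω] {P : Measure Ω}
  [IsProbabilityMeasure P] {Ω' : Type*} [MeasurableSpace Ω'] {P' : Measure Ω'}
  [IsProbabilityMeasure P'] {X : ℕ → Ω → ℝ}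

/-- The limit law of the quadratic statistic with a kernel of finite rank. -/
theorem tendsto_charFun_quadraticPart (hX : ∀ i, Measurable (X i)) (hind : iIndepFun X P)
    (hlaw : ∀ i, P.map (X i) = μ) {W : κ → Ω' → ℝ} (hWind : iIndepFun W P')
    (hWlaw : ∀ i, HasLaw (W i) (gaussianReal 0 1) P') (he : Orthonormal ℝ e)
    (h0 : ∀ i, ∫ x, e i x ∂μ = 0) (s : Finset κ) (t : ℝ) :
    Tendsto (fun n => charFun
        (P.map fun ω => quadraticPart (finiteRankKernel s ν e) n fun i => X i ω) t) atTop
      (𝓝 (charFun (P'.map fun ω => 3 * ∑ i ∈ s, ν i * (W i ω ^ 2 - 1)) t)) := by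
  have hme : ∀ i, Measurable (e i) := fun i => measurable_coe_Lp (e i)
  have hclt := tendstoInDistribution_orthonormal (P' := P') (ι := s) hX hind hlaw
    (W := fun i ω => W i ω) (hWind.precomp Subtype.val_injective) (fun i => hWlaw i)
    (g := fun i => e i) (fun i => hme i) (fun i => Lp.memLp (e i)) (fun i => h0 i)
    (fun i => by rw [integral_mul_eq_inner, real_inner_self_eq_norm_sq, he.1 i]; norm_num)
    (fun i j hij => by rw [integral_mul_eq_inner]; exact he.2 fun h => hij (Subtype.ext h))
  have hlln : ∀ᵐ ω ∂P, Tendsto (fun n : ℕ => ((n : ℝ) / ((n : ℝ) - 1),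
      ∑ i : s, ν i * ((∑ m ∈ Finset.range n, e i (X m ω) ^ 2) / n))) atTop
      (𝓝 ((1 : ℝ), ∑ i : s, ν i)) := by
    have hall : ∀ᵐ ω ∂P, ∀ i : s, Tendsto
        (fun n : ℕ => (∑ m ∈ Finset.range n, e i (X m ω) ^ 2) / n) atTop (𝓝 1) := by
      refine ae_all_iff.2 fun i => ?_
      have h := ae_tendsto_average hX hind hlaw ((hme i).pow_const 2) (Lp.memLp (e i)).integrable_sq
      have h1 : ∫ x, e i x ^ 2 ∂μ = 1 := by rw [← norm_sq_eq_integral, he.1 i]; norm_num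
      rwa [h1] at h
    filter_upwards [hall] with ω hω
    refine Tendsto.prodMk_nhds ?_ ?_
    · have := tendsto_natCast_div_add_atTop (-1 : ℝ)
      simpa [sub_eq_add_neg] using this
    · have := tendsto_finsetSum Finset.univ fun i _ => (hω i).const_mul (ν i)
      simpa using this
  have hmeas2 : ∀ n : ℕ, AEMeasurable (fun ω => ((n : ℝ) / ((n : ℝ) - 1),
      ∑ i : s, ν i * ((∑ m ∈ Finset.range n, e i (X m ω) ^ 2) / n))) P := by
    intro n
    have : ∀ i : s, Measurable fun ω => ∑ m ∈ Finset.range n, e i (X m ω) ^ 2 := fun i =>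
      Finset.measurable_sum _ fun m _ => ((hme i).comp (hX m)).pow_const 2
    fun_prop
  have hmeas := tendstoInMeasure_of_tendsto_ae (fun n => (hmeas2 n).aestronglyMeasurable) hlln
  -- Slutsky's theorem: the second component has a constant limit, so joint convergence passes
  -- through the continuous map `g`.
  have hlim := hclt.continuous_comp_prodMk_of_tendstoInMeasure_const
    (g := fun p : EuclideanSpace ℝ s × (ℝ × ℝ) =>
      3 * p.2.1 * (∑ i : s, ν i * p.1 i ^ 2 - p.2.2)) (by fun_prop) hmeas hmeas2
  have h := hlim.tendsto_charFun t
  have hZ : (fun ω => 3 * (1 : ℝ) * (∑ i : s, ν i * W i ω ^ 2 - ∑ i : s, ν i)) =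
      fun ω => 3 * ∑ i ∈ s, ν i * (W i ω ^ 2 - 1) := by
    ext ω
    rw [Finset.sum_coe_sort s fun i => ν i * W i ω ^ 2, Finset.sum_coe_sort s fun i => ν i,
      ← Finset.sum_sub_distrib, mul_one]
    simp only [mul_sub, mul_one]
  dsimp only at h
  rw [hZ] at h
  refine h.congr' ?_
  filter_upwards [eventually_ge_atTop 2] with n hn
  simp only [quadraticPart_finiteRankKernel s hn]

end QuadraticForm

/-! ### Almost sure convergence of the limit series -/

section GaussianSeries

theorem memLp_sq_sub_one_gaussianReal : MemLp (fun x : ℝ => x ^ 2 - 1) 2 (gaussianReal 0 1) := by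
  have h : ∀ k : ℕ, Integrable (fun x : ℝ => |x| ^ k) (gaussianReal 0 1) := by
    intro k
    by_cases hk : k = 0
    · simp [hk]
    · simpa using (memLp_id_gaussianReal (μ := 0) (v := 1) (k : NNReal)).integrable_norm_pow hk
  rw [memLp_two_iff_integrable_sq (by fun_prop)]
  have h4 := h 4
  have h2 := h 2
  simp only [sq_abs, show ∀ x : ℝ, |x| ^ 4 = x ^ 4 from fun x => by
    rw [← abs_pow, abs_of_nonneg (by positivity)]] at h2 h4
  refine ((h4.sub (h2.const_mul 2)).add (integrable_const 1)).congr
    (Eventually.of_forall fun x => ?_)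
  simp only [Pi.add_apply, Pi.sub_apply]
  ring

theorem integral_sq_sub_one_gaussianReal : ∫ x, (x ^ 2 - 1) ∂(gaussianReal 0 1) = 0 := by
  have h := variance_fun_id_gaussianReal (μ := 0) (v := 1)
  rw [variance_of_integral_eq_zero aemeasurable_id' integral_id_gaussianReal] at h
  have hint : Integrable (fun x : ℝ => x ^ 2) (gaussianReal 0 1) :=
    (memLp_id_gaussianReal (μ := 0) (v := 1) 2).integrable_sq
  rw [integral_sub hint (integrable_const _), h]
  simp

variable {Ω' : Type*} [MeasurableSpace Ω'] {P' : Measure Ω'} [IsProbabilityMeasure P']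
  {W : ℕ → Ω' → ℝ}

/-- Almost sure convergence of the weighted chi-square series. -/
theorem ae_exists_tendsto_sum_gaussian (hW : ∀ i, Measurable (W i)) (hind : iIndepFun W P')
    (hlaw : ∀ i, P'.map (W i) = gaussianReal 0 1) {ν : ℕ → ℝ}
    (hν : Summable fun i => ν i ^ 2) :
    ∀ᵐ ω ∂P', ∃ c, Tendsto (fun N : ℕ => ∑ i ∈ Finset.range N, ν i * (W i ω ^ 2 - 1)) atTop
      (𝓝 c) := by
  set ξ : ℕ → Ω' → ℝ := fun i ω => ν i * (W i ω ^ 2 - 1) with hξ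
  set C : ℝ := ∫ x, (x ^ 2 - 1) ^ 2 ∂(gaussianReal 0 1) with hC
  have hC0 : 0 ≤ C := integral_nonneg fun _ => sq_nonneg _
  have hm : ∀ i, Measurable (ξ i) := fun i => by fun_prop
  have hindξ : iIndepFun ξ P' :=
    hind.comp (fun i x => ν i * (x ^ 2 - 1)) fun i => by fun_prop
  have hL2 : ∀ i, MemLp (ξ i) 2 P' := by
    intro i
    refine MemLp.const_mul ?_ _
    refine (memLp_map_measure_iff (f := W i) (g := fun x : ℝ => x ^ 2 - 1) (by fun_prop)
      (hW i).aemeasurable).1 ?_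
    rw [hlaw i]
    exact memLp_sq_sub_one_gaussianReal
  have hint : ∀ i, Integrable (ξ i) P' := fun i => (hL2 i).integrable (by norm_num)
  have hmean : ∀ i, ∫ ω, ξ i ω ∂P' = 0 := by
    intro i
    rw [hξ]
    dsimp only
    rw [integral_const_mul,
      ← integral_map (φ := W i) (f := fun x : ℝ => x ^ 2 - 1) (hW i).aemeasurable (by fun_prop),
      hlaw i, integral_sq_sub_one_gaussianReal, mul_zero]
  have hsq : ∀ i, ∫ ω, ξ i ω ^ 2 ∂P' = ν i ^ 2 * C := by
    intro i
    simp only [hξ, mul_pow]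
    rw [integral_const_mul, ← integral_map (φ := W i) (f := fun x : ℝ => (x ^ 2 - 1) ^ 2)
      (hW i).aemeasurable (by fun_prop), hlaw i]
  -- The range ends at `N + 1` so that `M N` includes `ξ N` and the increment `ξ (N + 1)` is
  -- independent of the filtration at time `N`.
  set M : ℕ → Ω' → ℝ := fun N => ∑ i ∈ Finset.range (N + 1), ξ i with hM
  have hMint : ∀ N, Integrable (M N) P' := fun N => integrable_finsetSum' _ fun i _ => hint i
  have hML2 : ∀ N, MemLp (M N) 2 P' := fun N => memLp_finsetSum' _ fun i _ => hL2 i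
  have hMsq : ∀ N, ∫ ω, M N ω ^ 2 ∂P' ≤ C * ∑' i, ν i ^ 2 := by
    intro N
    simp only [hM, Finset.sum_apply]
    rw [integral_sq_sum_of_orthogonal _ ξ fun i _ => hL2 i]
    · simp only [hsq]
      rw [← Finset.sum_mul, mul_comm]
      exact mul_le_mul_of_nonneg_left (hν.sum_le_tsum _ fun _ _ => sq_nonneg _) hC0
    · intro i _ j _ hij
      rw [(hindξ.indepFun hij).integral_fun_mul_eq_mul_integral
        (hm i).aestronglyMeasurable (hm j).aestronglyMeasurable, hmean, zero_mul]
  let ℱ := Filtration.natural ξ fun i => (hm i).stronglyMeasurable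
  have hadapt : StronglyAdapted ℱ M := by
    intro N
    refine Finset.stronglyMeasurable_sum _ fun i hi => ?_
    exact (Filtration.stronglyAdapted_natural fun i => (hm i).stronglyMeasurable).stronglyMeasurable_le
      (Nat.lt_succ_iff.1 (Finset.mem_range.1 hi))
  have hmart : Martingale M ℱ P' := by
    refine martingale_nat hadapt hMint fun N => ?_
    have hstep : M (N + 1) = M N + ξ (N + 1) := by
      simp only [hM]
      rw [Finset.sum_range_succ _ (N + 1)]
    rw [hstep]
    have h1 := condExp_add (m := ℱ N) (hMint N) (hint (N + 1))
    have h2 := hindξ.condExp_natural_ae_eq_of_lt (fun i => (hm i).stronglyMeasurable)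
      (Nat.lt_succ_self N)
    rw [condExp_of_stronglyMeasurable (ℱ.le N) (hadapt N) (hMint N)] at h1
    filter_upwards [h1, h2] with ω hω1 hω2
    rw [hω1, Pi.add_apply, hω2, hmean, add_zero]
  -- Martingale convergence needs an `L¹` bound, which follows from the `L²` bound through `|x| ≤ 1
  -- + x ^ 2`.
  have hbdd : ∀ N, eLpNorm (M N) 1 P' ≤ (1 + C * ∑' i, ν i ^ 2).toNNReal := by
    intro N
    rw [eLpNorm_one_eq_lintegral_enorm, ← ofReal_integral_norm_eq_lintegral_enorm (hMint N)]
    refine ENNReal.ofReal_le_ofReal ?_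
    calc ∫ ω, ‖M N ω‖ ∂P' ≤ ∫ ω, (1 + M N ω ^ 2) ∂P' := by
          refine integral_mono (hMint N).norm ((integrable_const _).add (hML2 N).integrable_sq)
            fun ω => ?_
          dsimp only
          rw [Real.norm_eq_abs, ← sq_abs]
          nlinarith [sq_nonneg (|M N ω| - 1), abs_nonneg (M N ω)]
      _ ≤ 1 + C * ∑' i, ν i ^ 2 := by
          rw [integral_add (integrable_const _) (hML2 N).integrable_sq]
          simpa using hMsq N
  filter_upwards [hmart.submartingale.exists_ae_tendsto_of_bdd hbdd] with ω hω
  obtain ⟨c, hc⟩ := hω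
  refine ⟨c, (tendsto_add_atTop_iff_nat 1).1 ?_⟩
  simpa [hM, hξ] using hc

end GaussianSeries

/-! ### Characteristic functions of variables close in `L²` -/

section Approximation

variable {Ω : Type*} [MeasurableSpace Ω] {P : Measure Ω} [IsProbabilityMeasure P]

theorem integral_abs_le_sqrt {Z : Ω → ℝ} (hZ : MemLp Z 2 P) :
    ∫ ω, |Z ω| ∂P ≤ √(∫ ω, Z ω ^ 2 ∂P) := by
  refine Real.le_sqrt_of_sq_le ?_
  have h := variance_nonneg (fun ω => |Z ω|) P
  rw [variance_eq_sub (by simpa using hZ.norm)] at h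
  simp only [Pi.pow_apply, sq_abs] at h
  linarith

/-- The map `x ↦ exp(i t x)` is `|t|`-Lipschitz, and the `L¹` norm is at most the `L²` norm. -/
theorem norm_charFun_map_sub_le {Y Z : Ω → ℝ} (hY : AEMeasurable Y P) (hZ : AEMeasurable Z P)
    (h : MemLp (fun ω => Y ω - Z ω) 2 P) (t : ℝ) :
    ‖charFun (P.map Y) t - charFun (P.map Z) t‖ ≤
      |t| * √(∫ ω, (Y ω - Z ω) ^ 2 ∂P) := by
  have hbd : ∀ x : ℝ, ‖Complex.exp (x * Complex.I)‖ ≤ 1 := fun x => by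
    rw [Complex.norm_exp_ofReal_mul_I]
  have hint : ∀ {V : Ω → ℝ}, AEMeasurable V P →
      Integrable (fun ω => Complex.exp ((inner ℝ (V ω) t : ℝ) * Complex.I)) P := fun hV =>
    Integrable.of_bound (by fun_prop) 1 (Eventually.of_forall fun ω => hbd _)
  rw [charFun_map_eq_integral hY, charFun_map_eq_integral hZ, ← integral_sub (hint hY) (hint hZ)]
  refine le_trans ?_ (mul_le_mul_of_nonneg_left (integral_abs_le_sqrt h) (abs_nonneg t))
  rw [← integral_const_mul]
  refine norm_integral_le_of_norm_le ((h.integrable (by norm_num)).abs.const_mul _)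
    (Eventually.of_forall fun ω => ?_)
  have h1 : Complex.exp ((inner ℝ (Y ω) t : ℝ) * Complex.I) -
      Complex.exp ((inner ℝ (Z ω) t : ℝ) * Complex.I) =
      Complex.exp ((inner ℝ (Z ω) t : ℝ) * Complex.I) *
        (Complex.exp (Complex.I * (t * (Y ω - Z ω) : ℝ)) - 1) := by
    rw [mul_sub, ← Complex.exp_add, mul_one]
    congr 2
    simp only [RCLike.inner_apply, conj_trivial]
    push_cast
    ring
  rw [h1, norm_mul, Complex.norm_exp_ofReal_mul_I, one_mul]
  refine Real.norm_exp_I_mul_ofReal_sub_one_le.trans ?_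
  rw [Real.norm_eq_abs, abs_mul]

end Approximation

/-! ### Passage to the limit -/

section Limit

theorem measurable_statJ (n : ℕ) : Measurable (statJ n) := by
  unfold statJ
  simp only [kernelPhi_eq]
  refine Measurable.const_mul (Finset.measurable_sum _ fun k _ => Finset.measurable_sum _ fun j _ =>
    Finset.measurable_sum _ fun i _ => ?_) _
  exact (((measurable_kernelTerm_comp (measurable_pi_apply i) (measurable_pi_apply j)
    (measurable_pi_apply k)).add (measurable_kernelTerm_comp (measurable_pi_apply i)
    (measurable_pi_apply k) (measurable_pi_apply j))).add (measurable_kernelTerm_comp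
    (measurable_pi_apply j) (measurable_pi_apply k) (measurable_pi_apply i))).div_const 3

theorem measurable_quadraticPart {q : ℝ → ℝ → ℝ} (hq : Measurable fun p : ℝ × ℝ => q p.1 p.2)
    (n : ℕ) : Measurable (quadraticPart q n) := by
  unfold quadraticPart
  refine Measurable.const_mul (Finset.measurable_sum _ fun k _ => Finset.measurable_sum _ fun j _ =>
    ?_) _
  exact hq.comp (f := fun x : ℕ → ℝ => (x j, x k)) (by fun_prop)

theorem quadraticPart_sub (q r : ℝ → ℝ → ℝ) (n : ℕ) (x : ℕ → ℝ) :
    quadraticPart q n x - quadraticPart r n x = quadraticPart (fun s t => q s t - r s t) n x := by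
  simp only [quadraticPart, Finset.sum_sub_distrib, mul_sub]

variable {μ : Measure ℝ} [IsProbabilityMeasure μ]
  {Ω : Type*} [MeasurableSpace Ω] {P : Measure Ω} [IsProbabilityMeasure P] {X : ℕ → Ω → ℝ}
  {Ω' : Type*} [MeasurableSpace Ω'] {P' : Measure Ω'} [IsProbabilityMeasure P'] {W : ℕ → Ω' → ℝ}

/-- The law of `n J_n` is uniformly close to that of a quadratic statistic of finite rank. -/
theorem norm_charFun_statJ_sub_le (hcont : Continuous (cdf μ))
    (hH₀ : ∀ x : ℝ, 1 - cdf μ x - cdf μ (-x) = 0) (hX : ∀ i, Measurable (X i))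
    (hind : iIndepFun X P) (hlaw : ∀ i, P.map (X i) = μ) {κ : Type*} {ν : κ → ℝ}
    {e : κ → Lp ℝ 2 μ} (he : Orthonormal ℝ e) (hν : ∀ i, ν i ≠ 0)
    (hJ : ∀ i, opJ μ (e i) = ν i • e i) (s : Finset κ) (t : ℝ) {n : ℕ} (hn : 4 ≤ n) :
    ‖charFun (P.map fun ω => (n : ℝ) * statJ n fun i => X i ω) t -
      charFun (P.map fun ω => quadraticPart (finiteRankKernel s ν e) n fun i => X i ω) t‖ ≤
      |t| * √(9216 / n) +
        |t| * √(144 * (∫ x, ∫ y, projKernel μ x y ^ 2 ∂μ ∂μ - ∑ i ∈ s, ν i ^ 2)) := by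
  have hneg := map_neg_eq_self hcont hH₀
  have hXm : Measurable fun ω i => X i ω := measurable_pi_lambda _ hX
  have hm1 : AEMeasurable (fun ω => (n : ℝ) * statJ n fun i => X i ω) P :=
    (((measurable_statJ n).comp hXm).const_mul _).aemeasurable
  have hm2 : AEMeasurable (fun ω => quadraticPart (projKernel μ) n fun i => X i ω) P :=
    ((measurable_quadraticPart (measurable_projKernel μ) n).comp hXm).aemeasurable
  have hm3 : AEMeasurable
      (fun ω => quadraticPart (finiteRankKernel s ν e) n fun i => X i ω) P :=
    ((measurable_quadraticPart (measurable_finiteRankKernel s) n).comp hXm).aemeasurable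
  obtain ⟨hL1, hb1⟩ := integral_sq_mul_statJ_sub_le hX hind hlaw hcont hH₀ hn
  have hleft := integral_projKernel_sub_finiteRankKernel hneg hν hJ s
  obtain ⟨hL2, hb2⟩ := integral_sq_quadraticPart_le hX hind hlaw
    (fun p => projKernel μ p.1 p.2 - finiteRankKernel s ν e p.1 p.2)
    ((measurable_projKernel μ).sub (measurable_finiteRankKernel s))
    (memLp_projKernel_prod.sub (memLp_finiteRankKernel s)) hleft
    (fun x => by
      simp only [projKernel_comm μ x, finiteRankKernel_comm s x]
      exact hleft x) (show 2 ≤ n by omega)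
  rw [integral_sq_sub_finiteRankKernel he hJ] at hb2
  dsimp only at hL2 hb2
  simp only [← quadraticPart_sub] at hL2 hb2
  -- The full quadratic part is the intermediate term: the first error is the Hoeffding remainder,
  -- the second the truncation of the kernel.
  refine (norm_sub_le_norm_sub_add_norm_sub _
    (charFun (P.map fun ω => quadraticPart (projKernel μ) n fun i => X i ω) t) _).trans ?_
  refine add_le_add ((norm_charFun_map_sub_le hm1 hm2 hL1 t).trans ?_)
    ((norm_charFun_map_sub_le hm2 hm3 hL2 t).trans ?_)
  · exact mul_le_mul_of_nonneg_left (Real.sqrt_le_sqrt hb1) (abs_nonneg t)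
  · exact mul_le_mul_of_nonneg_left (Real.sqrt_le_sqrt hb2) (abs_nonneg t)

/-- The limit theorem for `n J_n` with measurable variables. -/
theorem tendstoInDistribution_statJ (hcont : Continuous (cdf μ))
    (hH₀ : ∀ x : ℝ, 1 - cdf μ x - cdf μ (-x) = 0) (hX : ∀ i, Measurable (X i))
    (hind : iIndepFun X P) (hlaw : ∀ i, P.map (X i) = μ) (hW : ∀ i, Measurable (W i))
    (hWind : iIndepFun W P') (hWlaw : ∀ i, P'.map (W i) = gaussianReal 0 1)
    {ν : ℕ → ℝ} (hν : IsEigenvalueSeq (opJ μ) ν) :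
    ∃ S : Ω' → ℝ,
      (∀ᵐ ω ∂P', Tendsto (fun N : ℕ => ∑ i ∈ Finset.range N, ν i * ((W i ω) ^ 2 - 1))
        atTop (𝓝 (S ω))) ∧
      TendstoInDistribution (fun (n : ℕ) ω => (n : ℝ) * statJ n (fun i => X i ω)) atTop
        (fun ω => 3 * S ω) (fun _ => P) P' := by
  classical
  have hsum := hν.hasSum_sq
  set H : ℝ := ∫ x, ∫ y, projKernel μ x y ^ 2 ∂μ ∂μ with hH
  obtain ⟨e, he, hJ, -⟩ := hν.exists_orthonormal
  have hneg := map_neg_eq_self hcont hH₀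
  have hex := ae_exists_tendsto_sum_gaussian hW hWind hWlaw hsum.summable
  let S : Ω' → ℝ := fun ω =>
    limUnder atTop fun N : ℕ => ∑ i ∈ Finset.range N, ν i * ((W i ω) ^ 2 - 1)
  have hS : ∀ᵐ ω ∂P', Tendsto (fun N : ℕ => ∑ i ∈ Finset.range N, ν i * ((W i ω) ^ 2 - 1))
      atTop (𝓝 (S ω)) := by
    filter_upwards [hex] with ω hω using tendsto_nhds_limUnder hω
  have hTm : ∀ N : ℕ, AEMeasurable
      (fun ω => ∑ i ∈ Finset.range N, ν i * ((W i ω) ^ 2 - 1)) P' := fun N => by fun_prop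
  have hSm : AEMeasurable S P' := aemeasurable_of_tendsto_metrizable_ae atTop hTm hS
  have hXm : Measurable fun ω i => X i ω := measurable_pi_lambda _ hX
  refine ⟨S, hS, tendstoInDistribution_of_charFun
    (fun n => (((measurable_statJ n).comp hXm).const_mul _).aemeasurable) (hSm.const_mul 3)
    fun t => ?_⟩
  -- Eigenvectors exist only for indices with `ν i ≠ 0`; the other indices below `N` add zero to the
  -- sums.
  let s : ℕ → Finset {i // ν i ≠ 0} := fun N => (Finset.range N).subtype fun i => ν i ≠ 0
  have hs : ∀ (N : ℕ) (f : ℕ → ℝ), (∀ i, ν i = 0 → f i = 0) →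
      ∑ i ∈ s N, f i = ∑ i ∈ Finset.range N, f i := by
    intro N f hf
    rw [Finset.sum_subtype_eq_sum_filter, Finset.sum_filter_of_ne]
    exact fun i _ hi h => hi (hf i h)
  have hδ : Tendsto (fun N => |t| * √(144 * (H - ∑ i ∈ s N, ν i ^ 2))) atTop (𝓝 0) := by
    have h1 : Tendsto (fun N => H - ∑ i ∈ s N, ν i ^ 2) atTop (𝓝 (H - H)) := by
      simp only [fun N => hs N (fun i => ν i ^ 2) fun i hi => by simp [hi]]
      exact hsum.tendsto_sum_nat.const_sub H
    have h2 := ((Real.continuous_sqrt.tendsto _).comp (h1.const_mul 144)).const_mul |t|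
    simpa using h2
  have hr : Tendsto (fun n : ℕ => |t| * √(9216 / n)) atTop (𝓝 0) := by
    have h1 := tendsto_const_div_atTop_nhds_zero_nat (9216 : ℝ)
    have h2 := ((Real.continuous_sqrt.tendsto _).comp h1).const_mul |t|
    simpa using h2
  have hc : Tendsto (fun N : ℕ => charFun
      (P'.map fun ω => 3 * ∑ i ∈ Finset.range N, ν i * ((W i ω) ^ 2 - 1)) t) atTop
      (𝓝 (charFun (P'.map fun ω => 3 * S ω) t)) := by
    have h3 : ∀ᵐ ω ∂P', Tendsto
        (fun N : ℕ => 3 * ∑ i ∈ Finset.range N, ν i * ((W i ω) ^ 2 - 1)) atTop (𝓝 (3 * S ω)) := by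
      filter_upwards [hS] with ω hω using hω.const_mul 3
    exact (tendstoInDistribution_of_ae_tendsto (fun N => (hTm N).const_mul 3) (hSm.const_mul 3)
      h3).tendsto_charFun t
  have hb : ∀ N, Tendsto (fun n => charFun (P.map fun ω =>
      quadraticPart (finiteRankKernel (s N) (fun i => ν i) e) n fun i => X i ω) t) atTop
      (𝓝 (charFun (P'.map fun ω => 3 * ∑ i ∈ Finset.range N, ν i * ((W i ω) ^ 2 - 1)) t)) := by
    intro N
    have h := tendsto_charFun_quadraticPart (P' := P') (ν := fun i : {i // ν i ≠ 0} => ν i)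
      (W := fun i : {i // ν i ≠ 0} => W i) hX hind hlaw (hWind.precomp Subtype.val_injective)
      (fun i => ⟨(hW i).aemeasurable, hWlaw i⟩) he
      (fun i => integral_eq_zero_of_opJ_eq hneg i.2 (hJ i)) (s N) t
    simpa only [fun ω => hs N (fun i => ν i * (W i ω ^ 2 - 1)) fun i hi => by simp [hi]] using h
  rw [Metric.tendsto_atTop]
  intro ε hε
  -- The rank `N` is fixed before `n`, which works because the truncation error is uniform in `n`.
  -- Four errors of `ε / 4` arise: truncation, tail of the limit series, Hoeffding remainder, finite
  -- rank limit.
  obtain ⟨N, hN1, hN2⟩ := ((hδ.eventually (gt_mem_nhds (show (0 : ℝ) < ε / 4 by positivity))).and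
    (hc.eventually (Metric.ball_mem_nhds _ (show (0 : ℝ) < ε / 4 by positivity)))).exists
  obtain ⟨n₀, hn₀⟩ := eventually_atTop.1
    ((hr.eventually (gt_mem_nhds (show (0 : ℝ) < ε / 4 by positivity))).and
      ((hb N).eventually (Metric.ball_mem_nhds _ (show (0 : ℝ) < ε / 4 by positivity))))
  refine ⟨max n₀ 4, fun n hn => ?_⟩
  obtain ⟨h1, h2⟩ := hn₀ n (le_of_max_le_left hn)
  have h3 := norm_charFun_statJ_sub_le hcont hH₀ hX hind hlaw he (fun i => i.2) hJ (s N) t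
    (le_of_max_le_right hn)
  rw [← dist_eq_norm] at h3
  have h4 := dist_triangle4 (charFun (P.map fun ω => (n : ℝ) * statJ n fun i => X i ω) t)
    (charFun (P.map fun ω =>
      quadraticPart (finiteRankKernel (s N) (fun i => ν i) e) n fun i => X i ω) t)
    (charFun (P'.map fun ω => 3 * ∑ i ∈ Finset.range N, ν i * ((W i ω) ^ 2 - 1)) t)
    (charFun (P'.map fun ω => 3 * S ω) t)
  linarith

end Limit

end

theorem theorem1
    -- the null distribution `μ`, with distribution function `F = cdf μ`
    (μ : Measure ℝ) [IsProbabilityMeasure μ]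
    (hcont : Continuous (cdf μ))
    (hH₀ : ∀ x : ℝ, 1 - cdf μ x - cdf μ (-x) = 0)
    -- the sample
    {Ω : Type*} [MeasurableSpace Ω] (P : Measure Ω) [IsProbabilityMeasure P]
    (X : ℕ → Ω → ℝ) (hXindep : iIndepFun X P) (hXlaw : ∀ i, HasLaw (X i) μ P)
    -- the standard normal sequence
    {Ω' : Type*} [MeasurableSpace Ω'] (P' : Measure Ω') [IsProbabilityMeasure P']
    (W : ℕ → Ω' → ℝ) (hWindep : iIndepFun W P') (hWlaw : ∀ i, HasLaw (W i) (gaussianReal 0 1) P') :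
    (∃ ν : ℕ → ℝ, IsEigenvalueSeq (opJ μ) ν ∧ Antitone (fun i => |ν i|)) ∧
    ∀ ν : ℕ → ℝ, IsEigenvalueSeq (opJ μ) ν →
      ∃ S : Ω' → ℝ,
        (∀ᵐ ω ∂P', Tendsto (fun N : ℕ => ∑ i ∈ Finset.range N, ν i * ((W i ω) ^ 2 - 1))
          atTop (𝓝 (S ω))) ∧
        TendstoInDistribution (fun (n : ℕ) ω => (n : ℝ) * statJ n (fun i => X i ω)) atTop
          (fun ω => ((Nat.choose 3 2 : ℕ) : ℝ) * S ω) (fun _ => P) P' := by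
  refine ⟨exists_isEigenvalueSeq_antitone μ, fun ν hν => ?_⟩
  -- The variables are only almost everywhere measurable. Measurable versions agree with them for
  -- all indices at once, off a null set, as there are countably many.
  have hXae : ∀ i, X i =ᵐ[P] (hXlaw i).aemeasurable.mk (X i) := fun i =>
    (hXlaw i).aemeasurable.ae_eq_mk
  have hWae : ∀ i, W i =ᵐ[P'] (hWlaw i).aemeasurable.mk (W i) := fun i =>
    (hWlaw i).aemeasurable.ae_eq_mk
  obtain ⟨S, hS, hlim⟩ := tendstoInDistribution_statJ hcont hH₀
    (fun i => (hXlaw i).aemeasurable.measurable_mk) (hXindep.congr hXae)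
    (fun i => (Measure.map_congr (hXae i)).symm.trans (hXlaw i).map_eq)
    (fun i => (hWlaw i).aemeasurable.measurable_mk) (hWindep.congr hWae)
    (fun i => (Measure.map_congr (hWae i)).symm.trans (hWlaw i).map_eq) hν
  refine ⟨S, ?_, ?_⟩
  · filter_upwards [hS, ae_all_iff.2 hWae] with ω hω hW
    simpa only [hW] using hω
  · have h3 : ((Nat.choose 3 2 : ℕ) : ℝ) = 3 := by norm_num [Nat.choose]
    rw [h3]
    refine hlim.congr (fun n => ?_) (EventuallyEq.refl _ _)
    filter_upwards [ae_all_iff.2 hXae] with ω hω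
    simp only [hω]
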